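/- Let $L>0$, $\mathbb T=\mathbb R/L\mathbb Z$ with Lebesgue measure, $\lambda=(2\pi/L)^4$, and let $H=\{u\in L^2(\mathbb T):\int_{\mathbb T}u\,dx=0\}$ carry the $L^2$ norm $\|\cdot\|$. Define $\phi:H\to[0,+\infty]$ by $\phi(u)=\int_{\mathbb T}\cosh(u_{xx})\,dx$ if $u\in H^2(\mathbb T)$ and $\phi(u)=+\infty$ otherwise; write $D(\phi)=\{\phi<\infty\}$. For $v\in D(\phi)$ let $|\partial\phi|(v)=\limsup_{w\to v}\frac{(\phi(v)-\phi(w))^+}{\|v-w\|}$, put $|\partial\phi|(v)=+\infty$ for $v\notin D(\phi)$, and let $D(|\partial\phi|)=\{|\partial\phi|<\infty\}$. For $\tau>0$ and $g\in H$ the functional $v\mapsto \Phi(\tau,g;v)=\phi(v)+\frac1{2\tau}\|v-g\|^2$ has exactly one minimizer over $H$, denoted $\mathcal J_\tau g$; and $h^*=0$ is the unique minimizer of $\phi$. For a partition $0=t_0<t_1<\cdots\to\infty$ with bounded steps and $h_0\in H$, a discrete solution is a sequence with $U_0=h_0$ and $U_{n}$ a minimizer of $\Phi(t_{n}-t_{n-1},U_{n-1};\cdot)$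 for $n\ge1$; its interpolant is $U_0$ at time $0$ and $U_n$ on $(t_{n-1},t_n]$. A curve $h:[0,\infty)\to H$ is a minimizing movement for $\Phi$ from $h_0$ if for every partition of sufficiently small mesh there is a discrete solution such that the interpolants converge in $H$ to $h(t)$ at every $t\ge0$ as the mesh tends to $0$. An EVI$_\lambda$ solution for $\phi$ from $h_0$ is a curve $h:[0,\infty)\to H$ that is absolutely continuous on every compact subinterval of $(0,\infty)$, with $\lim_{t\to0}h(t)=h_0=h(0)$, such that for a.e. $t>0$ and all $v\in D(\phi)$ the following derivative exists and $$\tfrac12\tfrac{d}{dt}\|h(t)-v\|^2+\tfrac\lambda2\|h(t)-v\|^2\le\phi(v)-\phi(h(t)).$$ **Proposition.** For every $h_0\in H$ there is a curve $h:[0,\infty)\to H$ such that: 1. $h$ is continuous on $[0,\infty)$, $h(0)=h_0$, $h$ is locally Lipschitz on $(0,\infty)$, $h$ is a minimizing movement for $\Phi$ from $h_0$, $(\mathcal J_{t/n})^n h_0\to h(t)$ in $L^2(\mathbb T)$ as $n\to\infty$ for every $t>0$, and $h$ is the unique EVI$_\lambda$ solution for $\phi$ from $h_0$. 2. For every $t>0$,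 $$\phi(h(t))\le\phi(v)+\tfrac1{2t}\|v-h_0\|^2\quad\forall v\in D(\phi),\qquad |\partial\phi|^2(h(t))\le|\partial\phi|^2(v)+\tfrac1{t^2}\|v-h_0\|^2\quad\forall v\in D(|\partial\phi|).$$ 3. For all $0\le t_0\le t$, $$\tfrac\lambda2\|h(t)-h^*\|^2\le\big(\phi(h(t_0))-\phi(h^*)\big)e^{-2\lambda(t-t_0)}$$ (where the right-hand side is $+\infty$ if $t_0=0$ and $\phi(h_0)=+\infty$). -/

import Mathlib

open MeasureTheory Set Filter Topology
open scoped ENNReal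

noncomputable section

namespace CrystalFlow

/-! ### Metric gradient-flow notions for a functional `φ : E → [0, ∞]` -/

section Metric

variable {E : Type*} [NormedAddCommGroup E]

/-- The penalized functional `Φ(τ, h; v) = φ(v) + ‖v - h‖² / (2τ)`. -/
def penalized (φ : E → ℝ≥0∞) (τ : ℝ) (h v : E) : ℝ≥0∞ :=
  φ v + ENNReal.ofReal (‖v - h‖ ^ 2 / (2 * τ))

/-- `v ∈ argmin Φ(τ, h; ·)`, a backward Euler step from `h` with step size `τ`. -/
def IsEulerStep (φ : E → ℝ≥0∞) (τ : ℝ) (h v : E) : Prop :=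
  ∀ w : E, penalized φ τ h v ≤ penalized φ τ h w

/-- The resolvent `J_τ h = argmin Φ(τ, h; ·)`, a chosen minimizer (whenever there is one). -/
def resolvent (φ : E → ℝ≥0∞) (τ : ℝ) (h : E) : E :=
  Classical.epsilon (IsEulerStep φ τ h)

/-- A partition `0 = t₀ < t₁ < t₂ < ⋯ → ∞` of `[0, ∞)` with bounded steps. -/
structure TimePartition where
  node : ℕ → ℝ
  node_zero : node 0 = 0
  strictMono : StrictMono node
  tendsto_atTop : Tendsto node atTop atTop
  bddAbove_steps : BddAbove (range fun n => node (n + 1) - node n)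

/-- The mesh size: the supremum of the steps. -/
def TimePartition.mesh (P : TimePartition) : ℝ :=
  ⨆ n, (P.node (n + 1) - P.node n)

/-- The piecewise constant interpolant, equal to `U n` on `(t_{n-1}, t_n]` and to `U 0` at `0`. -/
def TimePartition.interp (P : TimePartition) (U : ℕ → E) (t : ℝ) : E :=
  U (sInf {n : ℕ | t ≤ P.node n})

/-- `U` is a discrete solution of the minimizing-movement scheme along `P` started at `u₀`. -/
def IsDiscreteSolution (φ : E → ℝ≥0∞) (u₀ : E) (P : TimePartition) (U : ℕ → E) : Prop :=
  U 0 = u₀ ∧ ∀ n, IsEulerStep φ (P.node (n + 1) - P.node n) (U n) (U (n + 1))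

/-- `u` (restricted to `[0, ∞)`) is a minimizing movement for `Φ` started at `u₀`: for every
partition of sufficiently small mesh there is a discrete solution started at `u₀`, and the
interpolants of these converge to `u` at every time as the mesh tends to `0`. -/
def IsMinimizingMovement (φ : E → ℝ≥0∞) (u₀ : E) (u : ℝ → E) : Prop :=
  ∃ U : TimePartition → ℕ → E,
    (∃ δ > 0, ∀ P : TimePartition, P.mesh < δ → IsDiscreteSolution φ u₀ P (U P)) ∧
    ∀ t : ℝ, 0 ≤ t →
      Tendsto (fun P : TimePartition => P.interp (U P) t)
        (comap TimePartition.mesh (𝓝[>] 0)) (𝓝 (u t))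

/-- `u` is locally absolutely continuous on `(0, ∞)`. -/
def LocallyAC (u : ℝ → E) : Prop :=
  ∀ a b : ℝ, 0 < a → a ≤ b → AbsolutelyContinuousOnInterval u a b

/-- `u : [0, ∞) → E` (the values at negative times are irrelevant) is an `EVI_lam` solution for `φ`
started at `u₀`: it is locally absolutely continuous, `u(t) → u₀ = u(0)` as `t → 0`, and for almost
every `t > 0` and every `v ∈ D(φ)` the derivative below exists and
`½ d/dt ‖u(t) - v‖² + (lam/2) ‖u(t) - v‖² ≤ φ(v) - φ(u(t))`.
(If `φ (u t) = ∞` the right-hand side is `-∞` and the inequality fails.) -/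
def IsEVISolution (φ : E → ℝ≥0∞) (lam : ℝ) (u₀ : E) (u : ℝ → E) : Prop :=
  LocallyAC u ∧ Tendsto u (𝓝[≥] 0) (𝓝 u₀) ∧
    ∀ᵐ t ∂(volume.restrict (Ioi (0 : ℝ))), ∀ v : E, φ v ≠ ⊤ →
      ∃ d : ℝ, HasDerivAt (fun s => ‖u s - v‖ ^ 2) d t ∧
        ((1 / 2 * d + lam / 2 * ‖u t - v‖ ^ 2 : ℝ) : EReal) ≤ (φ v : EReal) - (φ (u t) : EReal)

open Classical in
/-- The local slope `|∂φ|(v) = limsup_{w → v, w ≠ v} (φ(v) - φ(w))⁺ / dist(v, w)` for `v ∈ D(φ)`,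
and `∞` off `D(φ)`.  Subtraction in `[0, ∞]` is truncated, i.e. it is the positive part. -/
def slope (φ : E → ℝ≥0∞) (v : E) : ℝ≥0∞ :=
  if φ v = ⊤ then ⊤ else limsup (fun w => (φ v - φ w) / edist v w) (𝓝[≠] v)

end Metric

/-! ### The space `H` and the functional on the circle of length `L` -/

section Circle

variable (L : ℝ) [Fact (0 < L)]

/-- `L²(𝕋)`, where `𝕋 = ℝ / Lℤ` carries Lebesgue measure (total mass `L`). -/
abbrev L2 : Type := Lp ℝ 2 (volume : Measure (AddCircle L))

/-- `H = {u ∈ L²(𝕋) : ∫ u = 0}`. -/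
def meanZero : Submodule ℝ (L2 L) where
  carrier := {u | ∫ x, u x = 0}
  zero_mem' := by
    change ∫ x, ((0 : L2 L) : AddCircle L → ℝ) x = 0
    rw [integral_congr_ae (Lp.coeFn_zero ℝ 2 volume)]
    simp
  add_mem' := by
    intro u v hu hv
    change ∫ x, (u + v : L2 L) x = 0
    rw [integral_congr_ae (Lp.coeFn_add u v)]
    have h1 : Integrable u := (Lp.memLp u).integrable one_le_two
    have h2 : Integrable v := (Lp.memLp v).integrable one_le_two
    simp only [Pi.add_apply]
    rw [integral_add h1 h2]
    rw [show ∫ x, u x = 0 from hu, show ∫ x, v x = 0 from hv, add_zero]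
  smul_mem' := by
    intro c u hu
    change ∫ x, (c • u : L2 L) x = 0
    rw [integral_congr_ae (Lp.coeFn_smul c u)]
    simp only [Pi.smul_apply]
    rw [integral_smul, show ∫ x, u x = 0 from hu, smul_zero]

/-- The Hilbert space `H` with the `L²` norm. -/
abbrev H : Type := meanZero L

variable {L}

/-- `g` is the weak derivative of `u` on the circle: `∫ u ψ' = - ∫ g ψ` for every smooth function
`ψ` on the circle (that is, every smooth `L`-periodic function on the line). -/
def IsWeakDeriv (u g : L2 L) : Prop :=
  ∀ ψ ψ' : AddCircle L → ℝ, ContDiff ℝ (⊤ : ℕ∞) (fun x : ℝ => ψ x) →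
    (∀ x : ℝ, HasDerivAt (fun y : ℝ => ψ y) (ψ' x) x) →
    ∫ x, u x * ψ' x = - ∫ x, g x * ψ x

/-- `u` has a weak first derivative in `L²`, whose weak derivative is `w ∈ L²`. -/
def IsWeakSecondDeriv (u w : L2 L) : Prop :=
  ∃ u' : L2 L, IsWeakDeriv u u' ∧ IsWeakDeriv u' w

/-- `u ∈ V = H²(𝕋) ∩ H`. -/
def MemV (u : H L) : Prop :=
  ∃ w : L2 L, IsWeakSecondDeriv (u : L2 L) w

open Classical in
/-- `φ(u) = ∫ cosh(u_xx) dx` for `u ∈ V`, and `φ(u) = ∞` otherwise. The second weak derivative is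
unique, so that the choice made here is immaterial. -/
def energy (u : H L) : ℝ≥0∞ :=
  if hu : MemV u then ∫⁻ x, ENNReal.ofReal (Real.cosh (hu.choose x)) else ⊤

end Circle

/-- `lam = (2π/L)⁴`. -/
def rate (L : ℝ) : ℝ := (2 * Real.pi / L) ^ 4

end CrystalFlow

end

/-! The argument is the Hilbert-space theory of gradient flows of a convex functional, applied to
`energy`. Everything abstract rests on `IsAdmissible`: lower semicontinuity, `lam`-convexity with
`lam ≥ 0`, and a dense domain.

By convexity an Euler step is the same as the inclusion `τ⁻¹ • (g - v) ∈ ∂φ(v)` (`isEulerStep_iff`),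
so two steps can be compared using monotonicity of `∂φ` alone. Iterating that comparison gives
Kobayashi's estimate `IsScheme.norm_sub_le` between two schemes with unrelated step sizes. Its error
is controlled by any point `x` with a subgradient `p`; such points are dense, so schemes from an
arbitrary initial point converge as their steps shrink. The limit curve (`IsFlow`) therefore does
not depend on the partition, which yields at once the minimizing movement, the exponential formula
and continuity.

The other bounds come from one discrete inequality, `IsScheme.regularizing`, which controls squared
speed, energy and distance together. In the limit it gives the energy bound, the slope bound and the
Lipschitz bound away from time zero. Its localized form `IsFlow.energy_le`, on intervals shrinking
to a time `t`, becomes the EVI with constant `0`; testing with points on the segment from `h t` to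
`v` upgrades the constant to `lam`. Two EVI solutions, one of them Lipschitz away from zero,
contract like `e^{-lam t}`. This gives uniqueness, and comparison with the constant curve at the
minimizer gives the decay.

For the circle, Parseval gives Wirtinger's inequality; applied twice, it bounds `‖u‖` by the second
derivative with constant `rate L`. Since `cosh'' ≥ 1`, the energy is then `rate L`-convex. Lower
semicontinuity combines Fatou's lemma with a nested-convex-set argument, and trigonometric
polynomials make the domain dense. -/

noncomputable section

namespace CrystalFlow

/-! ### Subgradients, Euler steps and estimates for discrete schemes -/

section Abstract

set_option linter.unusedSectionVars false

variable {E : Type*} [NormedAddCommGroup E] [InnerProductSpace ℝ E]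

/-- `φ` is `lam`-convex: `φ - (lam / 2) ‖·‖²` is convex on the domain of `φ`. -/
def IsLamConvex (φ : E → ℝ≥0∞) (lam : ℝ) : Prop :=
  ∀ u v : E, φ u ≠ ⊤ → φ v ≠ ⊤ → ∀ s : ℝ, 0 ≤ s → s ≤ 1 →
    φ ((1 - s) • u + s • v) ≠ ⊤ ∧
      (φ ((1 - s) • u + s • v)).toReal + lam / 2 * (s * (1 - s)) * ‖u - v‖ ^ 2
        ≤ (1 - s) * (φ u).toReal + s * (φ v).toReal

/-- `p` is a subgradient of `φ` at the point `u` of its domain. -/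
def IsSubgrad (φ : E → ℝ≥0∞) (u p : E) : Prop :=
  φ u ≠ ⊤ ∧ ∀ w, φ w ≠ ⊤ → (φ u).toReal + inner ℝ p (w - u) ≤ (φ w).toReal

/-- This is the final `s → 0` of every argument that tests with the point at parameter `s` on a
segment and divides by `s`. -/
theorem nonpos_of_forall_le_mul {a b : ℝ} (h : ∀ s : ℝ, 0 < s → s ≤ 1 → a ≤ s * b) : a ≤ 0 := by
  have ht : Tendsto (fun s : ℝ => s * b) (𝓝[>] 0) (𝓝 0) := by
    have : Tendsto (fun s : ℝ => s * b) (𝓝 0) (𝓝 (0 * b)) := tendsto_id.mul_const b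
    rw [zero_mul] at this
    exact this.mono_left nhdsWithin_le_nhds
  refine ge_of_tendsto ht ?_
  filter_upwards [Ioo_mem_nhdsGT (zero_lt_one' ℝ)] with s hs
  exact h s hs.1 hs.2.le

theorem toReal_le_of_lowerSemicontinuous {φ : E → ℝ≥0∞} (hφ : LowerSemicontinuous φ)
    {ι : Type*} {l : Filter ι} [NeBot l] {x : ι → E} {y : E} {c : ι → ℝ} {d : ℝ}
    (hx : Tendsto x l (𝓝 y)) (hc : Tendsto c l (𝓝 d))
    (h : ∀ᶠ i in l, φ (x i) ≠ ⊤ ∧ (φ (x i)).toReal ≤ c i) :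
    φ y ≠ ⊤ ∧ (φ y).toReal ≤ d := by
  have hd : 0 ≤ d := ge_of_tendsto hc (h.mono fun i hi => ENNReal.toReal_nonneg.trans hi.2)
  have key : φ y ≤ ENNReal.ofReal d := by
    refine le_of_forall_lt fun z hz => ?_
    obtain ⟨z', hz1, hz2⟩ := exists_between hz
    have h1 : ∀ᶠ i in l, z' < φ (x i) := hx.eventually (hφ y z' hz2)
    refine hz1.trans_le (ge_of_tendsto (ENNReal.tendsto_ofReal hc) ?_)
    filter_upwards [h1, h] with i hi1 hi2
    exact hi1.le.trans ((ENNReal.le_ofReal_iff_toReal_le hi2.1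
      (ENNReal.toReal_nonneg.trans hi2.2)).2 hi2.2)
  have hne : φ y ≠ ⊤ := ne_top_of_le_ne_top ENNReal.ofReal_ne_top key
  exact ⟨hne, (ENNReal.le_ofReal_iff_toReal_le hne hd).1 key⟩

/-- This replaces weak compactness. The elements of least norm in the `C n` have nondecreasing
bounded norms, and the projection inequality bounds `‖x m - x n‖ ^ 2` by the difference of the
squared norms, so they form a Cauchy sequence. -/
theorem exists_mem_of_antitone_convex [CompleteSpace E] {C : ℕ → Set E} (hanti : Antitone C)
    (hconv : ∀ n, Convex ℝ (C n)) (hclosed : ∀ n, IsClosed (C n)) (hne : ∀ n, (C n).Nonempty)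
    {R : ℝ} (hR : ∀ x ∈ C 0, ‖x‖ ≤ R) : ∃ x, ∀ n, x ∈ C n := by
  choose x hxC hx using fun n =>
    exists_norm_eq_iInf_of_complete_convex (hne n) (hclosed n).isComplete (hconv n) (0 : E)
  have hineq : ∀ n, ∀ w ∈ C n, ‖x n‖ ^ 2 ≤ inner ℝ (x n) w := by
    intro n w hw
    have := (norm_eq_iInf_iff_real_inner_le_zero (hconv n) (hxC n)).1 (hx n) w hw
    rw [zero_sub, inner_neg_left, inner_sub_right, real_inner_self_eq_norm_sq] at this
    linarith
  have hdist : ∀ n m, n ≤ m → ‖x m - x n‖ ^ 2 ≤ ‖x m‖ ^ 2 - ‖x n‖ ^ 2 := by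
    intro n m hnm
    have h1 := hineq n (x m) (hanti hnm (hxC m))
    rw [norm_sub_sq_real, real_inner_comm]
    linarith
  have hmono : Monotone fun n => ‖x n‖ ^ 2 := by
    intro n m hnm
    have := hdist n m hnm
    have h2 := sq_nonneg ‖x m - x n‖
    simp only
    linarith
  have hbdd : BddAbove (range fun n => ‖x n‖ ^ 2) := by
    refine ⟨R ^ 2, ?_⟩
    rintro _ ⟨n, rfl⟩
    exact pow_le_pow_left₀ (norm_nonneg _) (hR _ (hanti (Nat.zero_le n) (hxC n))) 2
  have hlim := tendsto_atTop_ciSup hmono hbdd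
  have hcauchy : CauchySeq x := by
    rw [Metric.cauchySeq_iff']
    intro ε hε
    have h1 : ∀ᶠ n in atTop, (⨆ n, ‖x n‖ ^ 2) - ε ^ 2 < ‖x n‖ ^ 2 :=
      hlim.eventually (lt_mem_nhds (by have := pow_pos hε 2; linarith))
    obtain ⟨N, hN⟩ := h1.exists
    refine ⟨N, fun n hn => ?_⟩
    have h2 := hdist N n hn
    have h3 := le_ciSup hbdd n
    rw [dist_eq_norm]
    refine lt_of_pow_lt_pow_left₀ 2 hε.le ?_
    linarith
  obtain ⟨y, hy⟩ := cauchySeq_tendsto_of_complete hcauchy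
  exact ⟨y, fun n => (hclosed n).mem_of_tendsto hy
    (eventually_atTop.2 ⟨n, fun m hm => hanti hm (hxC m)⟩)⟩

theorem penalized_le_ofReal_iff {φ : E → ℝ≥0∞} {τ : ℝ} (hτ : 0 < τ) {g v : E} {c : ℝ}
    (hc : 0 ≤ c) :
    penalized φ τ g v ≤ ENNReal.ofReal c ↔
      φ v ≠ ⊤ ∧ (φ v).toReal + ‖v - g‖ ^ 2 / (2 * τ) ≤ c := by
  unfold penalized
  have h0 : 0 ≤ ‖v - g‖ ^ 2 / (2 * τ) := by positivity
  by_cases hv : φ v = ⊤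
  · simp [hv]
  · have : φ v + ENNReal.ofReal (‖v - g‖ ^ 2 / (2 * τ))
        = ENNReal.ofReal ((φ v).toReal + ‖v - g‖ ^ 2 / (2 * τ)) := by
      rw [ENNReal.ofReal_add ENNReal.toReal_nonneg h0, ENNReal.ofReal_toReal hv]
    rw [this, ENNReal.ofReal_le_ofReal_iff hc]
    simp [hv]

theorem norm_sq_combo (a b : E) (s : ℝ) :
    ‖(1 - s) • a + s • b‖ ^ 2 = (1 - s) * ‖a‖ ^ 2 + s * ‖b‖ ^ 2 - s * (1 - s) * ‖a - b‖ ^ 2 := by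
  rw [norm_add_sq_real, norm_sub_sq_real, norm_smul, norm_smul, inner_smul_left, inner_smul_right]
  simp only [mul_pow, Real.norm_eq_abs, sq_abs, conj_trivial]
  ring

theorem isEulerStep_iff_real {φ : E → ℝ≥0∞} {τ : ℝ} (hτ : 0 < τ) (hp : ∃ x, φ x ≠ ⊤) {g v : E} :
    IsEulerStep φ τ g v ↔ φ v ≠ ⊤ ∧ ∀ w, φ w ≠ ⊤ →
      (φ v).toReal + ‖v - g‖ ^ 2 / (2 * τ) ≤ (φ w).toReal + ‖w - g‖ ^ 2 / (2 * τ) := by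
  have hpos : ∀ w, 0 ≤ (φ w).toReal + ‖w - g‖ ^ 2 / (2 * τ) := fun w => by
    have : 0 ≤ (φ w).toReal := ENNReal.toReal_nonneg
    positivity
  have heq : ∀ w, φ w ≠ ⊤ → penalized φ τ g w
      = ENNReal.ofReal ((φ w).toReal + ‖w - g‖ ^ 2 / (2 * τ)) := by
    intro w hw
    unfold penalized
    rw [ENNReal.ofReal_add ENNReal.toReal_nonneg (by positivity), ENNReal.ofReal_toReal hw]
  constructor
  · intro h
    obtain ⟨x, hx⟩ := hp
    have h1 := h x
    rw [heq x hx, penalized_le_ofReal_iff hτ (hpos x)] at h1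
    refine ⟨h1.1, fun w hw => ?_⟩
    have h2 := h w
    rw [heq w hw, penalized_le_ofReal_iff hτ (hpos w)] at h2
    exact h2.2
  · rintro ⟨hv, h⟩ w
    by_cases hw : φ w = ⊤
    · simp [penalized, hw]
    · rw [heq w hw, penalized_le_ofReal_iff hτ (hpos w)]
      exact ⟨hv, h w hw⟩

/-- First-order optimality: minimality is tested along the segment from `v` to `w`, and the
quadratic term is of second order in the parameter. Conversely, completing the square leaves a
nonnegative remainder. -/
theorem isEulerStep_iff {φ : E → ℝ≥0∞} {lam : ℝ} (hlam : 0 ≤ lam) (hconv : IsLamConvex φ lam)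
    (hp : ∃ x, φ x ≠ ⊤) {τ : ℝ} (hτ : 0 < τ) {g v : E} :
    IsEulerStep φ τ g v ↔ IsSubgrad φ v (τ⁻¹ • (g - v)) := by
  rw [isEulerStep_iff_real hτ hp]
  have hin : ∀ w, inner ℝ (τ⁻¹ • (g - v)) (w - v) = -(inner ℝ (v - g) (w - v) / τ) := by
    intro w
    rw [inner_smul_left, ← neg_sub v g, inner_neg_left]
    simp only [conj_trivial]
    field_simp
  constructor
  · rintro ⟨hv, h⟩
    refine ⟨hv, fun w hw => ?_⟩
    rw [hin]
    have key : (φ v).toReal - (inner ℝ (v - g) (w - v) / τ) - (φ w).toReal ≤ 0 := by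
      refine nonpos_of_forall_le_mul (b := ‖w - v‖ ^ 2 / (2 * τ)) fun s hs hs1 => ?_
      obtain ⟨h1, h2⟩ := hconv v w hv hw s hs.le hs1
      have h3 := h _ h1
      have h4 : (1 - s) • v + s • w - g = (v - g) + s • (w - v) := by
        rw [sub_smul, smul_sub, one_smul]; abel
      rw [h4, norm_add_sq_real, inner_smul_right, norm_smul, mul_pow, Real.norm_eq_abs, sq_abs]
        at h3
      have h5 : 0 ≤ lam / 2 * (s * (1 - s)) * ‖v - w‖ ^ 2 := by
        have : 0 ≤ 1 - s := by linarith
        positivity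
      have h6 : s * ((φ v).toReal - (inner ℝ (v - g) (w - v) / τ) - (φ w).toReal)
          ≤ s * (s * (‖w - v‖ ^ 2 / (2 * τ))) := by
        have e : (‖v - g‖ ^ 2 + 2 * (s * inner ℝ (v - g) (w - v)) + s ^ 2 * ‖w - v‖ ^ 2) / (2 * τ)
            = ‖v - g‖ ^ 2 / (2 * τ) + s * (inner ℝ (v - g) (w - v) / τ)
              + s * (s * (‖w - v‖ ^ 2 / (2 * τ))) := by
          field_simp
        rw [e] at h3
        linarith
      exact le_of_mul_le_mul_left h6 hs
    linarith
  · rintro ⟨hv, h⟩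
    refine ⟨hv, fun w hw => ?_⟩
    have h1 := h w hw
    rw [hin] at h1
    have h2 : w - g = (v - g) + (w - v) := by abel
    have h3 : 0 ≤ ‖w - v‖ ^ 2 / (2 * τ) := by positivity
    have e : ‖w - g‖ ^ 2 / (2 * τ) = ‖v - g‖ ^ 2 / (2 * τ) + inner ℝ (v - g) (w - v) / τ
        + ‖w - v‖ ^ 2 / (2 * τ) := by
      rw [h2, norm_add_sq_real]
      field_simp
    rw [e]
    linarith

theorem IsSubgrad.inner_nonneg {φ : E → ℝ≥0∞} {u v p q : E} (hu : IsSubgrad φ u p)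
    (hv : IsSubgrad φ v q) : 0 ≤ inner ℝ (p - q) (u - v) := by
  have h1 := hu.2 v hv.1
  have h2 := hv.2 u hu.1
  rw [← neg_sub u v, inner_neg_right] at h1
  rw [inner_sub_left]
  linarith

/-- The minimizers form the intersection of the sublevel sets at levels decreasing to the infimum.
These are nested, closed, convex and bounded, so they share a point. Uniqueness is monotonicity of
the subdifferential. -/
theorem existsUnique_isEulerStep [CompleteSpace E] {φ : E → ℝ≥0∞} {lam : ℝ} (hlam : 0 ≤ lam)
    (hconv : IsLamConvex φ lam) (hlsc : LowerSemicontinuous φ)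
    (hp : ∃ x, φ x ≠ ⊤) {τ : ℝ} (hτ : 0 < τ) (g : E) : ∃! v, IsEulerStep φ τ g v := by
  obtain ⟨x, hx⟩ := hp
  have hItop : (⨅ w, penalized φ τ g w) ≠ ⊤ := by
    refine ne_top_of_le_ne_top ?_ (iInf_le _ x)
    simp [penalized, hx]
  set I := (⨅ w, penalized φ τ g w).toReal with hI
  have hI0 : 0 ≤ I := ENNReal.toReal_nonneg
  have hIeq : (⨅ w, penalized φ τ g w) = ENNReal.ofReal I := (ENNReal.ofReal_toReal hItop).symm
  have hε : ∀ n : ℕ, (0 : ℝ) < 1 / (n + 1) := fun n => Nat.one_div_pos_of_nat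
  let C : ℕ → Set E := fun n => {v | penalized φ τ g v ≤ ENNReal.ofReal (I + 1 / (n + 1))}
  have hmem : ∀ n v, v ∈ C n ↔
      φ v ≠ ⊤ ∧ (φ v).toReal + ‖v - g‖ ^ 2 / (2 * τ) ≤ I + 1 / (n + 1) := fun n v =>
    penalized_le_ofReal_iff hτ (add_nonneg hI0 (hε n).le)
  have hanti : Antitone C := by
    intro n m hnm v hv
    exact le_trans hv (ENNReal.ofReal_le_ofReal
      (by have := Nat.one_div_le_one_div (α := ℝ) hnm; linarith))
  have hpl : LowerSemicontinuous (penalized φ τ g) := by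
    unfold penalized
    exact hlsc.add (ENNReal.continuous_ofReal.comp (by fun_prop)).lowerSemicontinuous
  have hcl : ∀ n, IsClosed (C n) := fun n => hpl.isClosed_preimage _
  have hne : ∀ n, (C n).Nonempty := by
    intro n
    have : (⨅ w, penalized φ τ g w) < ENNReal.ofReal (I + 1 / (n + 1)) := by
      rw [hIeq]
      exact (ENNReal.ofReal_lt_ofReal_iff (by have := hε n; linarith)).2 (by have := hε n; linarith)
    obtain ⟨w, hw⟩ := iInf_lt_iff.1 this
    exact ⟨w, hw.le⟩
  have hcv : ∀ n, Convex ℝ (C n) := by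
    intro n u hu v hv a b ha hb hab
    rw [hmem] at hu hv ⊢
    obtain rfl : a = 1 - b := by linarith
    obtain ⟨h1, h2⟩ := hconv u v hu.1 hv.1 b hb (by linarith)
    refine ⟨h1, ?_⟩
    have h4 : (1 - b) • u + b • v - g = (1 - b) • (u - g) + b • (v - g) := by
      simp only [sub_smul, smul_sub, one_smul]; abel
    have h5 : 0 ≤ lam / 2 * (b * (1 - b)) * ‖u - v‖ ^ 2 := by positivity
    have h6 : ‖(1 - b) • u + b • v - g‖ ^ 2 / (2 * τ)
        ≤ (1 - b) * (‖u - g‖ ^ 2 / (2 * τ)) + b * (‖v - g‖ ^ 2 / (2 * τ)) := by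
      rw [h4, norm_sq_combo, mul_div_assoc', mul_div_assoc', ← add_div]
      have : 0 ≤ b * (1 - b) * ‖u - g - (v - g)‖ ^ 2 := by positivity
      gcongr
      linarith
    have h7 := mul_le_mul_of_nonneg_left hu.2 ha
    have h8 := mul_le_mul_of_nonneg_left hv.2 hb
    linarith
  have hbd : ∀ v ∈ C 0, ‖v‖ ≤ ‖g‖ + (1 + 2 * τ * (I + 1)) := by
    intro v hv
    rw [hmem] at hv
    have h1 : ‖v - g‖ ^ 2 / (2 * τ) ≤ I + 1 := by
      have : 0 ≤ (φ v).toReal := ENNReal.toReal_nonneg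
      have h2 := hv.2
      norm_num at h2
      linarith
    rw [div_le_iff₀ (by positivity)] at h1
    have h2 : ‖v - g‖ ≤ 1 + 2 * τ * (I + 1) := by nlinarith [sq_nonneg (‖v - g‖ - 1)]
    have h3 : ‖v‖ ≤ ‖g‖ + ‖v - g‖ := by
      calc ‖v‖ = ‖g + (v - g)‖ := by congr 1; abel
        _ ≤ _ := norm_add_le _ _
    linarith
  obtain ⟨v, hv⟩ := exists_mem_of_antitone_convex hanti hcv hcl hne hbd
  have hvE : IsEulerStep φ τ g v := by
    intro w
    refine le_trans ?_ (iInf_le _ w)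
    rw [hIeq]
    have ht : Tendsto (fun n : ℕ => ENNReal.ofReal (I + 1 / (n + 1))) atTop
        (𝓝 (ENNReal.ofReal (I + 0))) :=
      ENNReal.tendsto_ofReal (tendsto_const_nhds.add tendsto_one_div_add_atTop_nhds_zero_nat)
    rw [add_zero] at ht
    exact ge_of_tendsto' ht hv
  refine ⟨v, hvE, fun w hw => ?_⟩
  have hw' : IsEulerStep φ τ g w := hw
  rw [isEulerStep_iff hlam hconv ⟨x, hx⟩ hτ] at hw' hvE
  have h1 := hw'.inner_nonneg hvE
  rw [← smul_sub, inner_smul_left, sub_sub_sub_cancel_left, ← neg_sub w v, inner_neg_left,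
    real_inner_self_eq_norm_sq] at h1
  simp only [conj_trivial] at h1
  have h2 : ‖w - v‖ ^ 2 ≤ 0 := by
    by_contra hcon
    have := mul_pos (inv_pos.2 hτ) (not_le.1 hcon)
    linarith
  have h3 : ‖w - v‖ = 0 := by
    have := sq_nonneg ‖w - v‖
    exact pow_eq_zero_iff two_ne_zero |>.1 (le_antisymm h2 this)
  exact sub_eq_zero.1 (norm_eq_zero.1 h3)

/-- A sequence of implicit Euler steps for the subdifferential of `φ`. -/
structure IsScheme (φ : E → ℝ≥0∞) (τ : ℕ → ℝ) (U : ℕ → E) : Prop where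
  pos : ∀ k, 0 < τ k
  sub : ∀ k, IsSubgrad φ (U (k + 1)) ((τ k)⁻¹ • (U k - U (k + 1)))

/-- Monotonicity, multiplied by `τ * σ` and followed by Cauchy–Schwarz. It is the recursion that
drives Kobayashi's estimate: each term on the right takes back a single step of one scheme. -/
theorem IsSubgrad.norm_step_le {φ : E → ℝ≥0∞} {τ σ : ℝ} (hτ : 0 < τ) (hσ : 0 < σ) {u u' v v' : E}
    (hu : IsSubgrad φ u' (τ⁻¹ • (u - u'))) (hv : IsSubgrad φ v' (σ⁻¹ • (v - v'))) :
    (τ + σ) * ‖u' - v'‖ ≤ σ * ‖u - v'‖ + τ * ‖u' - v‖ := by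
  have h := hu.inner_nonneg hv
  have e : (τ * σ) * inner ℝ (τ⁻¹ • (u - u') - σ⁻¹ • (v - v')) (u' - v')
      = σ * inner ℝ (u - v') (u' - v') + τ * inner ℝ (u' - v) (u' - v')
        - (τ + σ) * ‖u' - v'‖ ^ 2 := by
    have h1 : u - u' = (u - v') - (u' - v') := by abel
    have h2 : v - v' = (u' - v') - (u' - v) := by abel
    rw [inner_sub_left, inner_smul_left, inner_smul_left, h1, h2,
      inner_sub_left (u - v') (u' - v'), inner_sub_left (u' - v') (u' - v),
      real_inner_self_eq_norm_sq]
    simp only [conj_trivial]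
    field_simp
    ring
  have h3 := mul_nonneg (mul_pos hτ hσ).le h
  rw [e] at h3
  have h4 := real_inner_le_norm (u - v') (u' - v')
  have h5 := real_inner_le_norm (u' - v) (u' - v')
  rcases (norm_nonneg (u' - v')).eq_or_lt with h0 | h0
  · rw [← h0, mul_zero]; positivity
  · refine le_of_mul_le_mul_right ?_ h0
    have h6 := mul_le_mul_of_nonneg_left h4 hσ.le
    have h7 := mul_le_mul_of_nonneg_left h5 hτ.le
    nlinarith

theorem IsSubgrad.norm_step_sub_le {φ : E → ℝ≥0∞} {τ : ℝ} (hτ : 0 < τ) {u u' x p : E}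
    (hu : IsSubgrad φ u' (τ⁻¹ • (u - u'))) (hx : IsSubgrad φ x p) :
    ‖u' - x‖ ≤ ‖u - x‖ + ‖p‖ * τ := by
  -- The point `x` is itself the result of an Euler step, started from `x + τ • p`.
  have hx' : IsSubgrad φ x (τ⁻¹ • ((x + τ • p) - x)) := by
    rwa [add_sub_cancel_left, inv_smul_smul₀ hτ.ne']
  have h := hu.norm_step_le hτ hτ hx'
  have h1 : ‖u' - (x + τ • p)‖ ≤ ‖u' - x‖ + τ * ‖p‖ := by
    rw [← sub_sub]
    refine (norm_sub_le _ _).trans ?_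
    rw [norm_smul, Real.norm_eq_abs, abs_of_pos hτ]
  have h2 := mul_le_mul_of_nonneg_left h1 hτ.le
  refine le_of_mul_le_mul_left ?_ hτ
  linarith

theorem IsScheme.norm_sub_le_add {φ : E → ℝ≥0∞} {τ : ℕ → ℝ} {U : ℕ → E} (hU : IsScheme φ τ U)
    {x p : E} (hx : IsSubgrad φ x p) (m : ℕ) :
    ‖U m - x‖ ≤ ‖U 0 - x‖ + ‖p‖ * ∑ i ∈ Finset.range m, τ i := by
  induction m with
  | zero => simp
  | succ m ih =>
    rw [Finset.sum_range_succ, mul_add]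
    have := (hU.sub m).norm_step_sub_le (hU.pos m) hx
    linarith

/-- Kobayashi's estimate for two implicit Euler schemes with arbitrary step sizes. -/
theorem IsScheme.norm_sub_le {φ : E → ℝ≥0∞} {τ σ : ℕ → ℝ} {U V : ℕ → E} (hU : IsScheme φ τ U)
    (hV : IsScheme φ σ V) {x p : E} (hx : IsSubgrad φ x p) (m n : ℕ) :
    ‖U m - V n‖ ≤ ‖U 0 - x‖ + ‖V 0 - x‖ + ‖p‖ *
      √((∑ i ∈ Finset.range m, τ i - ∑ j ∈ Finset.range n, σ j) ^ 2
        + ∑ i ∈ Finset.range m, τ i ^ 2 + ∑ j ∈ Finset.range n, σ j ^ 2) := by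
  have hsq : ∀ (ρ : ℕ → ℝ) k, 0 ≤ ∑ i ∈ Finset.range k, ρ i ^ 2 := fun ρ k =>
    Finset.sum_nonneg fun i _ => sq_nonneg _
  induction m generalizing n with
  | zero =>
    have h1 := hV.norm_sub_le_add hx n
    have h2 : ‖U 0 - V n‖ ≤ ‖U 0 - x‖ + ‖V n - x‖ := by
      rw [← sub_sub_sub_cancel_right (U 0) (V n) x]; exact _root_.norm_sub_le _ _
    have h3 : ∑ j ∈ Finset.range n, σ j ≤
        √((∑ i ∈ Finset.range 0, τ i - ∑ j ∈ Finset.range n, σ j) ^ 2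
        + ∑ i ∈ Finset.range 0, τ i ^ 2 + ∑ j ∈ Finset.range n, σ j ^ 2) := by
      refine Real.le_sqrt_of_sq_le ?_
      simp only [Finset.range_zero, Finset.sum_empty, zero_sub, neg_sq, add_zero]
      linarith [hsq σ n]
    have h4 := mul_le_mul_of_nonneg_left h3 (norm_nonneg p)
    linarith
  | succ m ihm =>
    induction n with
    | zero =>
      have h1 := hU.norm_sub_le_add hx (m + 1)
      have h2 : ‖U (m + 1) - V 0‖ ≤ ‖U (m + 1) - x‖ + ‖V 0 - x‖ := by
        rw [← sub_sub_sub_cancel_right (U (m + 1)) (V 0) x]; exact _root_.norm_sub_le _ _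
      have h3 : ∑ j ∈ Finset.range (m + 1), τ j ≤
          √((∑ i ∈ Finset.range (m + 1), τ i - ∑ j ∈ Finset.range 0, σ j) ^ 2
          + ∑ i ∈ Finset.range (m + 1), τ i ^ 2 + ∑ j ∈ Finset.range 0, σ j ^ 2) := by
        refine Real.le_sqrt_of_sq_le ?_
        rw [Finset.sum_range_zero, Finset.sum_range_zero, sub_zero]
        linarith [hsq τ (m + 1)]
      have h4 := mul_le_mul_of_nonneg_left h3 (norm_nonneg p)
      linarith
    | succ n ihn =>
      have ha := hU.pos m
      have hb := hV.pos n
      have h := (hU.sub m).norm_step_le ha hb (hV.sub n)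
      have h1 := ihm (n + 1)
      set C := ‖U 0 - x‖ + ‖V 0 - x‖
      rw [Finset.sum_range_succ σ, Finset.sum_range_succ (fun j => σ j ^ 2)] at h1
      rw [Finset.sum_range_succ τ, Finset.sum_range_succ (fun i => τ i ^ 2)] at ihn
      rw [Finset.sum_range_succ σ, Finset.sum_range_succ (fun j => σ j ^ 2),
        Finset.sum_range_succ τ, Finset.sum_range_succ (fun i => τ i ^ 2)]
      have hA := hsq τ m
      have hB := hsq σ n
      set A := ∑ i ∈ Finset.range m, τ i ^ 2
      set B := ∑ i ∈ Finset.range n, σ i ^ 2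
      set S := ∑ i ∈ Finset.range m, τ i
      set T := ∑ i ∈ Finset.range n, σ i
      set a := τ m
      set b := σ n
      set R₁ := √((S - (T + b)) ^ 2 + A + (B + b ^ 2)) with hR1
      set R₂ := √((S + a - T) ^ 2 + (A + a ^ 2) + B) with hR2
      have q1 : R₁ ^ 2 = (S - (T + b)) ^ 2 + A + (B + b ^ 2) := Real.sq_sqrt (by positivity)
      have q2 : R₂ ^ 2 = (S + a - T) ^ 2 + (A + a ^ 2) + B := Real.sq_sqrt (by positivity)
      -- The new radicand is exactly the average of `R₁ ^ 2` and `R₂ ^ 2` with weights `b` and `a`,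
      -- since the terms linear in the time difference cancel. Convexity of the square then
      -- suffices.
      have key : (b * R₁ + a * R₂) / (a + b)
          ≤ √((S + a - (T + b)) ^ 2 + (A + a ^ 2) + (B + b ^ 2)) := by
        refine Real.le_sqrt_of_sq_le ?_
        rw [div_pow, div_le_iff₀ (by positivity)]
        have e : ((S + a - (T + b)) ^ 2 + (A + a ^ 2) + (B + b ^ 2)) * (a + b) ^ 2
            = (a + b) * (b * R₁ ^ 2 + a * R₂ ^ 2) := by
          rw [q1, q2]; ring
        rw [e]
        have := mul_nonneg (mul_pos ha hb).le (sq_nonneg (R₁ - R₂))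
        linarith
      rw [div_le_iff₀ (by positivity)] at key
      have k1 := mul_le_mul_of_nonneg_left h1 hb.le
      have k2 := mul_le_mul_of_nonneg_left ihn ha.le
      have k3 := mul_le_mul_of_nonneg_left key (norm_nonneg p)
      refine le_of_mul_le_mul_left ?_ (add_pos ha hb)
      linarith

/-- The discrete regularizing estimate for an implicit Euler scheme with constant step size. -/
theorem IsScheme.regularizing {φ : E → ℝ≥0∞} {τ : ℝ} {U : ℕ → E}
    (hU : IsScheme φ (fun _ => τ) U) {v : E} (hv : φ v ≠ ⊤) (n : ℕ) :
    ((n + 1) * τ) ^ 2 / 2 * ‖τ⁻¹ • (U n - U (n + 1))‖ ^ 2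
      + (n + 1) * τ * ((φ (U (n + 1))).toReal - (φ v).toReal) + ‖U (n + 1) - v‖ ^ 2 / 2
      ≤ ‖U 0 - v‖ ^ 2 / 2 := by
  have hτ : 0 < τ := hU.pos 0
  -- One step: expand `‖U k - v‖ ^ 2` around `U (k + 1)` and use the subgradient inequality at `v`.
  have step : ∀ k, τ ^ 2 / 2 * ‖τ⁻¹ • (U k - U (k + 1))‖ ^ 2
      + τ * ((φ (U (k + 1))).toReal - (φ v).toReal) + ‖U (k + 1) - v‖ ^ 2 / 2
      ≤ ‖U k - v‖ ^ 2 / 2 := by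
    intro k
    have h := (hU.sub k).2 v hv
    set P := τ⁻¹ • (U k - U (k + 1)) with hP
    have h1 : U k - v = τ • P - (v - U (k + 1)) := by
      rw [hP, smul_inv_smul₀ hτ.ne']; abel
    have h2 : ‖U k - v‖ ^ 2 = τ ^ 2 * ‖P‖ ^ 2 - 2 * (τ * inner ℝ P (v - U (k + 1)))
        + ‖U (k + 1) - v‖ ^ 2 := by
      rw [h1, norm_sub_sq_real, norm_smul, inner_smul_left, mul_pow, Real.norm_eq_abs, sq_abs,
        norm_sub_rev v]
      rfl
    have := mul_le_mul_of_nonneg_left h hτ.le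
    linarith
  induction n with
  | zero => simpa using step 0
  | succ n ih =>
    have h1 := step (n + 1)
    -- Energy dissipation, to be weighted by `(n + 1) * τ`, and decrease of the speed, to be
    -- weighted by `((n + 1) * τ) ^ 2 / 2`. With the `τ ^ 2 / 2` from `step`, the coefficients of
    -- `‖Q‖ ^ 2` add up to `((n + 2) * τ) ^ 2 / 2`.
    have h2 := (hU.sub (n + 1)).2 _ (hU.sub n).1
    have h3 := (hU.sub (n + 1)).inner_nonneg (hU.sub n)
    set P := τ⁻¹ • (U n - U (n + 1)) with hP
    set Q := τ⁻¹ • (U (n + 1) - U (n + 1 + 1)) with hQ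
    have e : U (n + 1) - U (n + 1 + 1) = τ • Q := by rw [hQ, smul_inv_smul₀ hτ.ne']
    rw [e, inner_smul_right, real_inner_self_eq_norm_sq] at h2
    rw [← neg_sub (U (n + 1)), e, inner_neg_right, inner_smul_right, inner_sub_left,
      real_inner_self_eq_norm_sq] at h3
    have h4 : ‖Q‖ ≤ ‖P‖ := by
      have h5 : ‖Q‖ ^ 2 ≤ inner ℝ P Q := by
        by_contra hcon
        have := mul_pos hτ (sub_pos.2 (not_le.1 hcon))
        linarith
      have h6 := real_inner_le_norm P Q
      by_contra hcon
      nlinarith [norm_nonneg P, norm_nonneg Q, mul_pos ((norm_nonneg P).trans_lt (not_le.1 hcon))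
        (sub_pos.2 (not_le.1 hcon))]
    have h5 : ‖Q‖ ^ 2 ≤ ‖P‖ ^ 2 := pow_le_pow_left₀ (norm_nonneg _) h4 2
    have h6 := mul_le_mul_of_nonneg_left h5 (show 0 ≤ ((n + 1) * τ) ^ 2 / 2 by positivity)
    have h7 := mul_le_mul_of_nonneg_left h2 (show 0 ≤ (n + 1) * τ by positivity)
    push_cast
    linarith

theorem IsScheme.norm_speed_le {φ : E → ℝ≥0∞} {τ : ℝ} {U : ℕ → E}
    (hU : IsScheme φ (fun _ => τ) U) (n : ℕ) :
    ‖τ⁻¹ • (U (n + 1) - U (n + 1 + 1))‖ ≤ ‖τ⁻¹ • (U n - U (n + 1))‖ := by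
  have hτ : 0 < τ := hU.pos 0
  have h := (hU.sub (n + 1)).norm_step_le hτ hτ (hU.sub n)
  rw [sub_self, norm_zero, mul_zero, zero_add] at h
  rw [norm_smul, norm_smul, norm_sub_rev (U (n + 1)), norm_sub_rev (U n)]
  have h1 : ‖U (n + 1 + 1) - U n‖ ≤ ‖U (n + 1 + 1) - U (n + 1)‖ + ‖U (n + 1) - U n‖ :=
    norm_sub_le_norm_sub_add_norm_sub _ _ _
  have h2 := mul_le_mul_of_nonneg_left h1 hτ.le
  refine mul_le_mul_of_nonneg_left ?_ (norm_nonneg _)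
  refine le_of_mul_le_mul_left ?_ hτ
  linarith

theorem IsScheme.shift {φ : E → ℝ≥0∞} {τ : ℝ} {U : ℕ → E} (hU : IsScheme φ (fun _ => τ) U)
    (j : ℕ) : IsScheme φ (fun _ => τ) (fun k => U (j + k)) :=
  ⟨fun k => hU.pos k, fun k => hU.sub (j + k)⟩

end Abstract

/-! ### The limit flow: construction, energy and slope bounds, Lipschitz regularity -/

section Flow

set_option linter.unusedSectionVars false

variable {E : Type*} [NormedAddCommGroup E] [InnerProductSpace ℝ E]

/-- `φ` is lower semicontinuous, `lam`-convex with `lam ≥ 0`, and its domain is dense. -/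
structure IsAdmissible (φ : E → ℝ≥0∞) (lam : ℝ) : Prop where
  nonneg : 0 ≤ lam
  convex : IsLamConvex φ lam
  lsc : LowerSemicontinuous φ
  dense : Dense {v | φ v ≠ ⊤}

theorem IsAdmissible.proper {φ : E → ℝ≥0∞} {lam : ℝ} (h : IsAdmissible φ lam) :
    ∃ x, φ x ≠ ⊤ := h.dense.nonempty

theorem IsSubgrad.le_add_mul_norm {φ : E → ℝ≥0∞} {x p : E} (h : IsSubgrad φ x p) :
    ∀ w, φ w ≠ ⊤ → (φ x).toReal ≤ (φ w).toReal + ‖p‖ * ‖w - x‖ := by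
  intro w hw
  have h1 := h.2 w hw
  have h2 := abs_le.1 (abs_real_inner_le_norm p (w - x))
  linarith

variable [CompleteSpace E]

theorem IsAdmissible.isEulerStep_resolvent {φ : E → ℝ≥0∞} {lam : ℝ} (h : IsAdmissible φ lam)
    {τ : ℝ} (hτ : 0 < τ) (g : E) : IsEulerStep φ τ g (resolvent φ τ g) :=
  Classical.epsilon_spec
    (existsUnique_isEulerStep h.nonneg h.convex h.lsc h.proper hτ g).exists

theorem IsAdmissible.isSubgrad_resolvent {φ : E → ℝ≥0∞} {lam : ℝ} (h : IsAdmissible φ lam)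
    {τ : ℝ} (hτ : 0 < τ) (g : E) :
    IsSubgrad φ (resolvent φ τ g) (τ⁻¹ • (g - resolvent φ τ g)) :=
  (isEulerStep_iff h.nonneg h.convex h.proper hτ).1 (h.isEulerStep_resolvent hτ g)

/-- The implicit Euler scheme with step sizes `τ` started at `u₀`. -/
def eulerScheme (φ : E → ℝ≥0∞) (τ : ℕ → ℝ) (u₀ : E) : ℕ → E
  | 0 => u₀
  | k + 1 => resolvent φ (τ k) (eulerScheme φ τ u₀ k)

theorem IsAdmissible.isScheme {φ : E → ℝ≥0∞} {lam : ℝ} (h : IsAdmissible φ lam)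
    {τ : ℕ → ℝ} (hτ : ∀ k, 0 < τ k) (u₀ : E) : IsScheme φ τ (eulerScheme φ τ u₀) :=
  ⟨hτ, fun k => h.isSubgrad_resolvent (hτ k) _⟩

/-- Resolvents of points in the domain carry subgradients and are close to those points. This is
what allows initial data of infinite energy. -/
theorem IsAdmissible.exists_isSubgrad_near {φ : E → ℝ≥0∞} {lam : ℝ} (h : IsAdmissible φ lam)
    (u₀ : E) {ε : ℝ} (hε : 0 < ε) : ∃ x p, IsSubgrad φ x p ∧ ‖u₀ - x‖ < ε := by
  obtain ⟨v, hv, hd⟩ := h.dense.exists_dist_lt u₀ (half_pos hε)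
  rw [dist_eq_norm] at hd
  have hv0 : 0 ≤ (φ v).toReal := ENNReal.toReal_nonneg
  -- Minimality gives `‖w - v‖ ^ 2 ≤ 2 * τ * φ v`; this `τ` brings the right side below `(ε / 2) ^
  -- 2`, and the `+ 1` covers `φ v = 0`.
  set τ := (ε / 2) ^ 2 / (4 * ((φ v).toReal + 1)) with hτdef
  have hτ : 0 < τ := by positivity
  refine ⟨_, _, h.isSubgrad_resolvent hτ v, ?_⟩
  set w := resolvent φ τ v
  have h1 := ((isEulerStep_iff_real hτ h.proper).1 (h.isEulerStep_resolvent hτ v)).2 v hv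
  rw [sub_self, norm_zero] at h1
  have hw0 : 0 ≤ (φ w).toReal := ENNReal.toReal_nonneg
  have h2 : ‖w - v‖ ^ 2 / (2 * τ) ≤ (φ v).toReal := by
    norm_num at h1
    linarith
  rw [div_le_iff₀ (by positivity)] at h2
  have h3 : ‖w - v‖ ^ 2 < (ε / 2) ^ 2 := by
    have : (φ v).toReal * (2 * τ) = (ε / 2) ^ 2 * ((φ v).toReal / (2 * ((φ v).toReal + 1))) := by
      rw [hτdef]; field_simp; ring
    rw [this] at h2
    refine h2.trans_lt (mul_lt_of_lt_one_right (by positivity) ?_)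
    rw [div_lt_one (by positivity)]
    linarith
  have h4 : ‖w - v‖ < ε / 2 := lt_of_pow_lt_pow_left₀ 2 (by positivity) h3
  have h5 : ‖u₀ - w‖ ≤ ‖u₀ - v‖ + ‖w - v‖ := by
    rw [norm_sub_rev w]; exact norm_sub_le_norm_sub_add_norm_sub _ _ _
  linarith

/-- `y` is the value, up to time error `δ`, of an implicit Euler scheme at time `t` with
steps at most `δ`. -/
def IsApprox (φ : E → ℝ≥0∞) (u₀ : E) (t δ : ℝ) (y : E) : Prop :=
  ∃ (τ : ℕ → ℝ) (U : ℕ → E) (m : ℕ), IsScheme φ τ U ∧ U 0 = u₀ ∧ (∀ i, τ i ≤ δ) ∧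
    |∑ i ∈ Finset.range m, τ i - t| ≤ δ ∧ U m = y

/-- Kobayashi's estimate with the step sizes eliminated: a sum of squared steps is at most the
largest step times the total time. -/
theorem IsApprox.norm_sub_le {φ : E → ℝ≥0∞} {u₀ : E} {t r δ η : ℝ} {y z : E}
    (hy : IsApprox φ u₀ t δ y) (hz : IsApprox φ u₀ r η z) {x p : E} (hx : IsSubgrad φ x p) :
    ‖y - z‖ ≤ 2 * ‖u₀ - x‖
      + ‖p‖ * √((|t - r| + δ + η) ^ 2 + δ * (t + δ) + η * (r + η)) := by
  obtain ⟨τ, U, m, hU, hU0, hτ, hm, rfl⟩ := hy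
  obtain ⟨σ, V, n, hV, hV0, hσ, hn, rfl⟩ := hz
  have h := hU.norm_sub_le hV hx m n
  rw [hU0, hV0] at h
  have sq : ∀ (ρ : ℕ → ℝ) (ε s : ℝ) (k : ℕ), (∀ i, 0 < ρ i) → (∀ i, ρ i ≤ ε) →
      |∑ i ∈ Finset.range k, ρ i - s| ≤ ε → ∑ i ∈ Finset.range k, ρ i ^ 2 ≤ ε * (s + ε) := by
    intro ρ ε s k hρ hρε hs
    have hε : 0 ≤ ε := (hρ 0).le.trans (hρε 0)
    calc ∑ i ∈ Finset.range k, ρ i ^ 2 ≤ ∑ i ∈ Finset.range k, ε * ρ i := by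
          refine Finset.sum_le_sum fun i _ => ?_
          rw [pow_two]
          exact mul_le_mul_of_nonneg_right (hρε i) (hρ i).le
      _ = ε * ∑ i ∈ Finset.range k, ρ i := by rw [Finset.mul_sum]
      _ ≤ _ := mul_le_mul_of_nonneg_left (by linarith [(abs_le.1 hs).2]) hε
  have h1 := sq τ δ t m hU.pos hτ hm
  have h2 := sq σ η r n hV.pos hσ hn
  have h3 : (∑ i ∈ Finset.range m, τ i - ∑ j ∈ Finset.range n, σ j) ^ 2
      ≤ (|t - r| + δ + η) ^ 2 := by
    rw [← sq_abs]
    refine pow_le_pow_left₀ (abs_nonneg _) ?_ 2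
    have e : ∑ i ∈ Finset.range m, τ i - ∑ j ∈ Finset.range n, σ j
        = (t - r) + (∑ i ∈ Finset.range m, τ i - t) + -(∑ j ∈ Finset.range n, σ j - r) := by ring
    rw [e]
    refine (abs_add_three _ _ _).trans ?_
    rw [abs_neg]
    linarith
  refine h.trans ?_
  rw [two_mul]
  gcongr

theorem tendsto_isApprox_bound (a b t : ℝ) {ι : Type*} {l : Filter ι} {δ : ι → ℝ}
    (hδ : Tendsto δ l (𝓝 0)) :
    Tendsto (fun i => a + b * √((δ i) ^ 2 + δ i * (t + δ i))) l (𝓝 a) := by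
  have hc : Continuous fun d : ℝ => a + b * √(d ^ 2 + d * (t + d)) := by fun_prop
  have := (hc.tendsto 0).comp hδ
  simpa [Function.comp_def] using this

theorem abs_ceil_mul_sub_le {t τ : ℝ} (ht : 0 ≤ t) (hτ : 0 < τ) :
    |(⌈t / τ⌉₊ : ℝ) * τ - t| ≤ τ := by
  have h1 : t ≤ (⌈t / τ⌉₊ : ℝ) * τ := by
    rw [← div_le_iff₀ hτ]; exact Nat.le_ceil _
  have h2 : (⌈t / τ⌉₊ : ℝ) * τ ≤ t + τ := by
    have := (Nat.ceil_lt_add_one (div_nonneg ht hτ.le)).le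
    calc (⌈t / τ⌉₊ : ℝ) * τ ≤ (t / τ + 1) * τ := by gcongr
      _ = t + τ := by field_simp
  rw [abs_le]
  constructor <;> linarith

theorem IsScheme.isApprox_const {φ : E → ℝ≥0∞} {τ : ℝ} {U : ℕ → E}
    (hU : IsScheme φ (fun _ => τ) U) {t : ℝ} (ht : 0 ≤ t) :
    IsApprox φ (U 0) t τ (U ⌈t / τ⌉₊) := by
  refine ⟨fun _ => τ, U, ⌈t / τ⌉₊, hU, rfl, fun _ => le_rfl, ?_, rfl⟩
  rw [Finset.sum_const, Finset.card_range, nsmul_eq_mul]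
  exact abs_ceil_mul_sub_le ht (hU.pos 0)

/-- `h` is the limit of all implicit Euler schemes started at `u₀`, with a quantitative rate. -/
def IsFlow (φ : E → ℝ≥0∞) (u₀ : E) (h : ℝ → E) : Prop :=
  ∀ t, 0 ≤ t → ∀ δ y, IsApprox φ u₀ t δ y → ∀ x p, IsSubgrad φ x p →
    ‖y - h t‖ ≤ 2 * ‖u₀ - x‖ + ‖p‖ * √(δ ^ 2 + δ * (t + δ))

/-- Uniform grids of step `1 / (N + 1)` give a Cauchy sequence at each time: choose `x` near `u₀`
first, then `N` large against `‖p‖`. Comparing any other scheme with these grids and letting `N → ∞`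
gives the rate. -/
theorem IsAdmissible.exists_isFlow {φ : E → ℝ≥0∞} {lam : ℝ} (hφ : IsAdmissible φ lam) (u₀ : E) :
    ∃ h, IsFlow φ u₀ h := by
  have main : ∀ t : ℝ, ∃ z : E, 0 ≤ t → ∀ δ y, IsApprox φ u₀ t δ y → ∀ x p, IsSubgrad φ x p →
      ‖y - z‖ ≤ 2 * ‖u₀ - x‖ + ‖p‖ * √(δ ^ 2 + δ * (t + δ)) := by
    intro t
    by_cases ht : 0 ≤ t
    swap
    · exact ⟨0, fun h => absurd h ht⟩
    let τ : ℕ → ℝ := fun N => 1 / ((N : ℝ) + 1)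
    have hτ : ∀ N, 0 < τ N := fun N => Nat.one_div_pos_of_nat
    have hτ0 : Tendsto τ atTop (𝓝 0) := tendsto_one_div_add_atTop_nhds_zero_nat
    have hτanti : Antitone τ := fun n m hnm => Nat.one_div_le_one_div hnm
    let z : ℕ → E := fun N => eulerScheme φ (fun _ => τ N) u₀ ⌈t / τ N⌉₊
    have hz : ∀ N, IsApprox φ u₀ t (τ N) (z N) := fun N =>
      (hφ.isScheme (fun _ => hτ N) u₀).isApprox_const ht
    have hcauchy : CauchySeq z := by
      rw [Metric.cauchySeq_iff']
      intro ε hε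
      obtain ⟨x, p, hx, hxε⟩ := hφ.exists_isSubgrad_near u₀ (show 0 < ε / 2 by positivity)
      have hlim : Tendsto (fun N => 2 * ‖u₀ - x‖
          + ‖p‖ * √((|t - t| + τ N + τ N) ^ 2 + τ N * (t + τ N) + τ N * (t + τ N))) atTop
          (𝓝 (2 * ‖u₀ - x‖)) := by
        have hc : Continuous fun d : ℝ => 2 * ‖u₀ - x‖
          + ‖p‖ * √((|t - t| + d + d) ^ 2 + d * (t + d) + d * (t + d)) := by fun_prop
        have := (hc.tendsto 0).comp hτ0
        simpa [Function.comp_def] using this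
      obtain ⟨N, hN⟩ := (hlim.eventually (gt_mem_nhds (show 2 * ‖u₀ - x‖ < ε by linarith))).exists
      refine ⟨N, fun n hn => ?_⟩
      rw [dist_eq_norm]
      refine lt_of_le_of_lt ?_ hN
      refine ((hz n).norm_sub_le (hz N) hx).trans ?_
      have h1 := hτanti hn
      have h2 := hτ n
      gcongr
    obtain ⟨y, hy⟩ := cauchySeq_tendsto_of_complete hcauchy
    refine ⟨y, fun _ δ w hw x p hx => ?_⟩
    have hlim : Tendsto (fun N => 2 * ‖u₀ - x‖
        + ‖p‖ * √((|t - t| + δ + τ N) ^ 2 + δ * (t + δ) + τ N * (t + τ N))) atTop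
        (𝓝 (2 * ‖u₀ - x‖ + ‖p‖ * √(δ ^ 2 + δ * (t + δ)))) := by
      have hc : Continuous fun d : ℝ => 2 * ‖u₀ - x‖
        + ‖p‖ * √((|t - t| + δ + d) ^ 2 + δ * (t + δ) + d * (t + d)) := by fun_prop
      have := (hc.tendsto 0).comp hτ0
      simpa [Function.comp_def] using this
    exact le_of_tendsto_of_tendsto' (tendsto_const_nhds.sub hy).norm hlim
      fun N => hw.norm_sub_le (hz N) hx
  choose h hh using main
  exact ⟨h, fun t ht => hh t ht⟩

theorem IsFlow.tendsto {φ : E → ℝ≥0∞} {lam : ℝ} (hφ : IsAdmissible φ lam) {u₀ : E} {h : ℝ → E}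
    (hh : IsFlow φ u₀ h) {t : ℝ} (ht : 0 ≤ t) {ι : Type*} {l : Filter ι} {δ : ι → ℝ} {y : ι → E}
    (hδ : Tendsto δ l (𝓝 0)) (hy : ∀ᶠ i in l, IsApprox φ u₀ t (δ i) (y i)) :
    Tendsto y l (𝓝 (h t)) := by
  rw [Metric.tendsto_nhds]
  intro ε hε
  obtain ⟨x, p, hx, hxε⟩ := hφ.exists_isSubgrad_near u₀ (show 0 < ε / 2 by positivity)
  have hlim := tendsto_isApprox_bound (2 * ‖u₀ - x‖) ‖p‖ t hδ
  filter_upwards [hy, hlim.eventually (gt_mem_nhds (show 2 * ‖u₀ - x‖ < ε by linarith))]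
    with i hi hi2
  rw [dist_eq_norm]
  exact (hh t ht _ _ hi x p hx).trans_lt hi2

theorem IsFlow.zero {φ : E → ℝ≥0∞} {lam : ℝ} (hφ : IsAdmissible φ lam) {u₀ : E} {h : ℝ → E}
    (hh : IsFlow φ u₀ h) : h 0 = u₀ := by
  have hap : ∀ N : ℕ, IsApprox φ u₀ 0 (1 / ((N : ℝ) + 1)) u₀ := fun N =>
    ⟨fun _ => 1 / ((N : ℝ) + 1), _, 0, hφ.isScheme (fun _ => Nat.one_div_pos_of_nat) u₀, rfl,
      fun _ => le_rfl, by simp; positivity, rfl⟩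
  exact tendsto_nhds_unique (hh.tendsto hφ le_rfl tendsto_one_div_add_atTop_nhds_zero_nat
    (Eventually.of_forall hap)) tendsto_const_nhds

theorem resolvent_iterate {φ : E → ℝ≥0∞} (τ : ℝ) (u₀ : E) (n : ℕ) :
    (resolvent φ τ)^[n] u₀ = eulerScheme φ (fun _ => τ) u₀ n := by
  induction n with
  | zero => rfl
  | succ n ih => rw [Function.iterate_succ_apply', ih]; rfl

theorem IsFlow.tendsto_resolvent {φ : E → ℝ≥0∞} {lam : ℝ} (hφ : IsAdmissible φ lam) {u₀ : E}
    {h : ℝ → E} (hh : IsFlow φ u₀ h) {t : ℝ} (ht : 0 < t) :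
    Tendsto (fun n : ℕ => (resolvent φ (t / n))^[n] u₀) atTop (𝓝 (h t)) := by
  refine hh.tendsto hφ ht.le (δ := fun n : ℕ => t / n) (tendsto_const_div_atTop_nhds_zero_nat t) ?_
  filter_upwards [eventually_gt_atTop 0] with n hn
  have hn' : (0 : ℝ) < n := Nat.cast_pos.2 hn
  rw [resolvent_iterate]
  refine ⟨fun _ => t / n, _, n, hφ.isScheme (fun _ => by positivity) u₀, rfl, fun _ => le_rfl,
    ?_, rfl⟩
  rw [Finset.sum_const, Finset.card_range, nsmul_eq_mul, mul_div_cancel₀ _ hn'.ne', sub_self,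
    abs_zero]
  positivity

theorem TimePartition.step_le_mesh (P : TimePartition) (n : ℕ) :
    P.node (n + 1) - P.node n ≤ P.mesh :=
  le_ciSup P.bddAbove_steps n

theorem IsFlow.isMinimizingMovement {φ : E → ℝ≥0∞} {lam : ℝ} (hφ : IsAdmissible φ lam) {u₀ : E}
    {h : ℝ → E} (hh : IsFlow φ u₀ h) : IsMinimizingMovement φ u₀ h := by
  have hpos : ∀ (P : TimePartition) k, 0 < P.node (k + 1) - P.node k := fun P k =>
    sub_pos.2 (P.strictMono (Nat.lt_succ_self k))
  refine ⟨fun P => eulerScheme φ (fun k => P.node (k + 1) - P.node k) u₀, ⟨1, one_pos, ?_⟩, ?_⟩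
  · exact fun P _ => ⟨rfl, fun n => hφ.isEulerStep_resolvent (hpos P n) _⟩
  · intro t ht
    refine hh.tendsto hφ ht (δ := TimePartition.mesh)
      (tendsto_comap.mono_right nhdsWithin_le_nhds) (Eventually.of_forall fun P => ?_)
    refine ⟨_, _, sInf {n : ℕ | t ≤ P.node n}, hφ.isScheme (hpos P) u₀, rfl, P.step_le_mesh,
      ?_, rfl⟩
    rw [Finset.sum_range_sub, P.node_zero, sub_zero]
    have hne : {n : ℕ | t ≤ P.node n}.Nonempty :=
      (P.tendsto_atTop.eventually_ge_atTop t).exists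
    have h1 : t ≤ P.node (sInf {n : ℕ | t ≤ P.node n}) := Nat.sInf_mem hne
    rw [abs_of_nonneg (sub_nonneg.2 h1)]
    -- The first node at or after `t` overshoots by at most one step, because the preceding node
    -- lies before `t`. At index `0` there is no preceding node, but the overshoot is `-t ≤ 0`.
    rcases hk : sInf {n : ℕ | t ≤ P.node n} with _ | k
    · rw [P.node_zero]
      have := (hpos P 0).le.trans (P.step_le_mesh 0)
      linarith
    · have h2 : k ∉ {n : ℕ | t ≤ P.node n} := Nat.notMem_of_lt_sInf (by omega)
      have h3 : P.node k < t := not_le.1 h2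
      have := P.step_le_mesh k
      linarith

/-- A sequence of constant-step schemes converging to the flow. -/
theorem IsFlow.exists_grid {φ : E → ℝ≥0∞} {lam : ℝ} (hφ : IsAdmissible φ lam) {u₀ : E}
    {h : ℝ → E} (hh : IsFlow φ u₀ h) : ∃ (τ : ℕ → ℝ) (V : ℕ → ℕ → E),
      (∀ N, IsScheme φ (fun _ => τ N) (V N)) ∧ (∀ N, V N 0 = u₀) ∧ Tendsto τ atTop (𝓝 0) ∧
      (∀ a, 0 ≤ a → Tendsto (fun N => V N ⌈a / τ N⌉₊) atTop (𝓝 (h a))) ∧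
      (∀ a, 0 ≤ a → Tendsto (fun N => (⌈a / τ N⌉₊ : ℝ) * τ N) atTop (𝓝 a)) := by
  let τ : ℕ → ℝ := fun N => 1 / ((N : ℝ) + 1)
  have hτ : ∀ N, 0 < τ N := fun N => Nat.one_div_pos_of_nat
  have hτ0 : Tendsto τ atTop (𝓝 0) := tendsto_one_div_add_atTop_nhds_zero_nat
  refine ⟨τ, fun N => eulerScheme φ (fun _ => τ N) u₀, fun N => hφ.isScheme (fun _ => hτ N) u₀,
    fun N => rfl, hτ0, fun a ha => ?_, fun a ha => ?_⟩
  · exact hh.tendsto hφ ha hτ0 (Eventually.of_forall fun N =>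
      (hφ.isScheme (fun _ => hτ N) u₀).isApprox_const ha)
  · rw [tendsto_iff_dist_tendsto_zero]
    exact squeeze_zero (fun _ => dist_nonneg)
      (fun N => abs_ceil_mul_sub_le ha (hτ N)) hτ0

theorem IsFlow.norm_sub_le {φ : E → ℝ≥0∞} {lam : ℝ} (hφ : IsAdmissible φ lam) {u₀ : E}
    {h : ℝ → E} (hh : IsFlow φ u₀ h) {a b : ℝ} (ha : 0 ≤ a) (hb : 0 ≤ b) {x p : E}
    (hx : IsSubgrad φ x p) : ‖h a - h b‖ ≤ 2 * ‖u₀ - x‖ + ‖p‖ * |a - b| := by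
  obtain ⟨τ, V, hV, hV0, hτ0, hlim, -⟩ := hh.exists_grid hφ
  have hlim2 : Tendsto (fun N => 2 * ‖u₀ - x‖
      + ‖p‖ * √((|a - b| + τ N + τ N) ^ 2 + τ N * (a + τ N) + τ N * (b + τ N))) atTop
      (𝓝 (2 * ‖u₀ - x‖ + ‖p‖ * |a - b|)) := by
    have hc : Continuous fun d : ℝ => 2 * ‖u₀ - x‖
      + ‖p‖ * √((|a - b| + d + d) ^ 2 + d * (a + d) + d * (b + d)) := by fun_prop
    have := (hc.tendsto 0).comp hτ0
    simpa [Real.sqrt_sq_eq_abs, Function.comp_def] using this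
  refine le_of_tendsto_of_tendsto' ((hlim a ha).sub (hlim b hb)).norm hlim2 fun N => ?_
  have h1 := (hV N).isApprox_const ha
  have h2 := (hV N).isApprox_const hb
  rw [hV0] at h1 h2
  exact h1.norm_sub_le h2 hx

theorem IsFlow.continuousOn {φ : E → ℝ≥0∞} {lam : ℝ} (hφ : IsAdmissible φ lam) {u₀ : E}
    {h : ℝ → E} (hh : IsFlow φ u₀ h) : ContinuousOn h (Ici 0) := by
  intro a ha
  rw [ContinuousWithinAt, Metric.tendsto_nhds]
  intro ε hε
  obtain ⟨x, p, hx, hxε⟩ := hφ.exists_isSubgrad_near u₀ (show 0 < ε / 2 by positivity)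
  have hc : Continuous fun b => 2 * ‖u₀ - x‖ + ‖p‖ * |b - a| := by fun_prop
  have hc' := hc.tendsto a
  simp only [sub_self, abs_zero, mul_zero, add_zero] at hc'
  filter_upwards [self_mem_nhdsWithin, (hc'.mono_left nhdsWithin_le_nhds).eventually
    (gt_mem_nhds (show 2 * ‖u₀ - x‖ < ε by linarith))] with b hb hb2
  rw [dist_eq_norm]
  exact (hh.norm_sub_le hφ hb ha hx).trans_lt hb2

theorem eventually_ceil_lt {a b : ℝ} (ha : 0 ≤ a) (hab : a < b) {τ : ℕ → ℝ}
    (hpos : ∀ N, 0 < τ N) (hτ : Tendsto τ atTop (𝓝 0)) :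
    ∀ᶠ N in atTop, ⌈a / τ N⌉₊ < ⌈b / τ N⌉₊ := by
  filter_upwards [hτ.eventually (gt_mem_nhds (sub_pos.2 hab))] with N hN
  rw [Nat.lt_ceil]
  have := Nat.ceil_lt_add_one (div_nonneg ha (hpos N).le)
  refine this.trans ?_
  rw [div_add_one (hpos N).ne']
  exact div_lt_div_of_pos_right (by linarith) (hpos N)

/-- The energy inequality on a time interval. -/
theorem IsFlow.energy_le {φ : E → ℝ≥0∞} {lam : ℝ} (hφ : IsAdmissible φ lam) {u₀ : E}
    {h : ℝ → E} (hh : IsFlow φ u₀ h) {a b : ℝ} (ha : 0 ≤ a) (hab : a < b) {v : E}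
    (hv : φ v ≠ ⊤) : φ (h b) ≠ ⊤ ∧
      (φ (h b)).toReal ≤ (φ v).toReal + (‖h a - v‖ ^ 2 / 2 - ‖h b - v‖ ^ 2 / 2) / (b - a) := by
  obtain ⟨τ, V, hV, hV0, hτ0, hlim, hgrid⟩ := hh.exists_grid hφ
  have hpos : ∀ N, 0 < τ N := fun N => (hV N).pos 0
  have hb : 0 ≤ b := ha.trans hab.le
  have hlim2 : Tendsto (fun N => (φ v).toReal + (‖V N ⌈a / τ N⌉₊ - v‖ ^ 2 / 2
      - ‖V N ⌈b / τ N⌉₊ - v‖ ^ 2 / 2) / ((⌈b / τ N⌉₊ : ℝ) * τ N - (⌈a / τ N⌉₊ : ℝ) * τ N)) atTop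
      (𝓝 ((φ v).toReal + (‖h a - v‖ ^ 2 / 2 - ‖h b - v‖ ^ 2 / 2) / (b - a))) := by
    refine tendsto_const_nhds.add (Tendsto.div ?_ ((hgrid b hb).sub (hgrid a ha))
      (sub_pos.2 hab).ne')
    exact ((((hlim a ha).sub_const v).norm.pow 2).div_const 2).sub
      ((((hlim b hb).sub_const v).norm.pow 2).div_const 2)
  refine toReal_le_of_lowerSemicontinuous hφ.lsc (hlim b hb) hlim2 ?_
  filter_upwards [eventually_ceil_lt ha hab hpos hτ0] with N hN
  obtain ⟨n, hn⟩ := Nat.exists_eq_add_of_lt hN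
  -- The scheme is restarted at the grid time of `a`, from which `n + 1` steps lead to that of `b`.
  -- The speed term is discarded.
  have h1 := ((hV N).shift ⌈a / τ N⌉₊).regularizing hv n
  rw [add_zero] at h1
  rw [hn]
  refine ⟨((hV N).sub _).1, ?_⟩
  have h2 : ((⌈a / τ N⌉₊ + n + 1 : ℕ) : ℝ) * τ N - (⌈a / τ N⌉₊ : ℝ) * τ N = (n + 1) * τ N := by
    push_cast; ring
  have h3 : 0 < (n + 1) * τ N := by have := hpos N; positivity
  rw [h2, ← sub_le_iff_le_add', le_div_iff₀ h3]
  have h4 : 0 ≤ ((n + 1) * τ N) ^ 2 / 2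
      * ‖(τ N)⁻¹ • (V N (⌈a / τ N⌉₊ + n) - V N (⌈a / τ N⌉₊ + (n + 1)))‖ ^ 2 := by positivity
  simp only [← add_assoc] at h1 h4
  linarith

/-- The hypothesis `hS` bounds the energy drop below `v` by `S * ‖U (n + 1) - v‖`. After Young's
inequality the resulting quadratic term is absorbed exactly by the distance term of
`IsScheme.regularizing`. -/
theorem IsScheme.speed_sq_le {φ : E → ℝ≥0∞} {τ : ℝ} {U : ℕ → E}
    (hU : IsScheme φ (fun _ => τ) U) {v : E} (hv : φ v ≠ ⊤) {S : ℝ}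
    (hS : ∀ w, φ w ≠ ⊤ → (φ v).toReal ≤ (φ w).toReal + S * ‖w - v‖) (n : ℕ) :
    ‖τ⁻¹ • (U n - U (n + 1))‖ ^ 2 ≤ S ^ 2 + ‖U 0 - v‖ ^ 2 / ((n + 1) * τ) ^ 2 := by
  have hτ : 0 < τ := hU.pos 0
  have h1 := hU.regularizing hv n
  have h2 := hS _ (hU.sub n).1
  set b := (n + 1) * τ with hb
  have hb0 : 0 < b := by positivity
  have h3 := mul_le_mul_of_nonneg_left h2 hb0.le
  have h4 := sq_nonneg (b * S - ‖U (n + 1) - v‖)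
  rw [← sub_le_iff_le_add', le_div_iff₀ (by positivity)]
  linarith

/-- The slope bound, in the form of a global inequality. -/
theorem IsFlow.energy_le_add_mul {φ : E → ℝ≥0∞} {lam : ℝ} (hφ : IsAdmissible φ lam) {u₀ : E}
    {h : ℝ → E} (hh : IsFlow φ u₀ h) {t : ℝ} (ht : 0 < t) {v : E}
    (hv : φ v ≠ ⊤) {S : ℝ} (hS : ∀ w, φ w ≠ ⊤ → (φ v).toReal ≤ (φ w).toReal + S * ‖w - v‖)
    {w : E} (hw : φ w ≠ ⊤) :
    (φ (h t)).toReal ≤ (φ w).toReal + √(S ^ 2 + ‖u₀ - v‖ ^ 2 / t ^ 2) * ‖w - h t‖ := by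
  obtain ⟨τ, V, hV, hV0, hτ0, hlim, hgrid⟩ := hh.exists_grid hφ
  have hpos : ∀ N, 0 < τ N := fun N => (hV N).pos 0
  have hlim2 : Tendsto (fun N => (φ w).toReal
      + √(S ^ 2 + ‖u₀ - v‖ ^ 2 / ((⌈t / τ N⌉₊ : ℝ) * τ N) ^ 2) * ‖w - V N ⌈t / τ N⌉₊‖) atTop
      (𝓝 ((φ w).toReal + √(S ^ 2 + ‖u₀ - v‖ ^ 2 / t ^ 2) * ‖w - h t‖)) := by
    refine tendsto_const_nhds.add (Tendsto.mul ?_ (tendsto_const_nhds.sub (hlim t ht.le)).norm)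
    exact (tendsto_const_nhds.add (tendsto_const_nhds.div ((hgrid t ht.le).pow 2)
      (by positivity))).sqrt
  refine (toReal_le_of_lowerSemicontinuous hφ.lsc (hlim t ht.le) hlim2
    (Eventually.of_forall fun N => ?_)).2
  -- Since `t > 0`, the index is a successor, so the point is the output of a step and its discrete
  -- speed is a subgradient there. The global inequality survives the limit although the
  -- subgradients themselves need not converge.
  obtain ⟨n, hn⟩ := Nat.exists_eq_succ_of_ne_zero (Nat.ceil_pos.2 (div_pos ht (hpos N))).ne'
  rw [hn]
  refine ⟨((hV N).sub n).1, ?_⟩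
  have h1 := (hV N).speed_sq_le hv hS n
  rw [hV0] at h1
  have h2 := ((hV N).sub n).le_add_mul_norm w hw
  refine h2.trans ?_
  push_cast
  gcongr
  exact Real.le_sqrt_of_sq_le h1

/-- The discrete speed never increases, so each later step is at most `τ` times the speed of step
`j`. -/
theorem IsScheme.norm_sub_le_speed {φ : E → ℝ≥0∞} {τ : ℝ} {U : ℕ → E}
    (hU : IsScheme φ (fun _ => τ) U) (j i : ℕ) :
    ‖U (j + 1) - U (j + 1 + i)‖ ≤ i * τ * ‖τ⁻¹ • (U j - U (j + 1))‖ := by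
  have hτ : 0 < τ := hU.pos 0
  have hmono : ∀ i, ‖τ⁻¹ • (U (j + i) - U (j + i + 1))‖ ≤ ‖τ⁻¹ • (U j - U (j + 1))‖ := by
    intro i
    induction i with
    | zero => exact le_rfl
    | succ i ih => exact (hU.norm_speed_le (j + i)).trans ih
  induction i with
  | zero => simp
  | succ i ih =>
    have h1 : ‖U (j + 1) - U (j + 1 + (i + 1))‖
        ≤ ‖U (j + 1) - U (j + 1 + i)‖ + ‖U (j + 1 + i) - U (j + 1 + (i + 1))‖ :=
      norm_sub_le_norm_sub_add_norm_sub _ _ _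
    have h2 : ‖U (j + 1 + i) - U (j + 1 + (i + 1))‖ ≤ τ * ‖τ⁻¹ • (U j - U (j + 1))‖ := by
      have h3 := hmono (i + 1)
      rw [norm_smul τ⁻¹ (U (j + (i + 1)) - _), norm_inv, Real.norm_eq_abs, abs_of_pos hτ,
        inv_mul_le_iff₀ hτ] at h3
      have e : j + 1 + i = j + (i + 1) := by ring
      rw [← add_assoc (j + 1), e]
      exact h3
    push_cast
    linarith

theorem IsFlow.norm_sub_le_mul {φ : E → ℝ≥0∞} {lam : ℝ} (hφ : IsAdmissible φ lam) {u₀ : E}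
    {h : ℝ → E} (hh : IsFlow φ u₀ h) {a b : ℝ} (ha : 0 < a) (hab : a ≤ b) {x p : E}
    (hx : IsSubgrad φ x p) :
    ‖h a - h b‖ ≤ (b - a) * √(‖p‖ ^ 2 + ‖u₀ - x‖ ^ 2 / a ^ 2) := by
  obtain ⟨τ, V, hV, hV0, hτ0, hlim, hgrid⟩ := hh.exists_grid hφ
  have hpos : ∀ N, 0 < τ N := fun N => (hV N).pos 0
  have hb : 0 ≤ b := ha.le.trans hab
  have hlim2 : Tendsto (fun N => ((⌈b / τ N⌉₊ : ℝ) * τ N - (⌈a / τ N⌉₊ : ℝ) * τ N)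
      * √(‖p‖ ^ 2 + ‖u₀ - x‖ ^ 2 / ((⌈a / τ N⌉₊ : ℝ) * τ N) ^ 2)) atTop
      (𝓝 ((b - a) * √(‖p‖ ^ 2 + ‖u₀ - x‖ ^ 2 / a ^ 2))) := by
    refine ((hgrid b hb).sub (hgrid a ha.le)).mul ?_
    exact (tendsto_const_nhds.add (tendsto_const_nhds.div ((hgrid a ha.le).pow 2)
      (by positivity))).sqrt
  refine le_of_tendsto_of_tendsto' ((hlim a ha.le).sub (hlim b hb)).norm hlim2 fun N => ?_
  obtain ⟨j, hj⟩ := Nat.exists_eq_succ_of_ne_zero (Nat.ceil_pos.2 (div_pos ha (hpos N))).ne'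
  have hle : ⌈a / τ N⌉₊ ≤ ⌈b / τ N⌉₊ :=
    Nat.ceil_mono (div_le_div_of_nonneg_right hab (hpos N).le)
  obtain ⟨i, hi⟩ := Nat.exists_eq_add_of_le hle
  rw [hi, hj]
  have h1 := (hV N).norm_sub_le_speed j i
  have h2 := (hV N).speed_sq_le hx.1 hx.le_add_mul_norm j
  rw [hV0] at h2
  refine h1.trans ?_
  have e : ((j.succ + i : ℕ) : ℝ) * τ N - (j.succ : ℝ) * τ N = i * τ N := by push_cast; ring
  rw [e]
  have := hpos N
  refine mul_le_mul_of_nonneg_left (Real.le_sqrt_of_sq_le ?_) (by positivity)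
  push_cast
  exact h2

theorem IsFlow.exists_lipschitzOnWith {φ : E → ℝ≥0∞} {lam : ℝ} (hφ : IsAdmissible φ lam) {u₀ : E}
    {h : ℝ → E} (hh : IsFlow φ u₀ h) {a : ℝ} (ha : 0 < a) :
    ∃ K, LipschitzOnWith K h (Ici a) := by
  obtain ⟨x, p, hx, -⟩ := hφ.exists_isSubgrad_near u₀ one_pos
  refine ⟨Real.toNNReal √(‖p‖ ^ 2 + ‖u₀ - x‖ ^ 2 / a ^ 2), ?_⟩
  have key : ∀ r s, a ≤ r → r ≤ s →
      ‖h r - h s‖ ≤ √(‖p‖ ^ 2 + ‖u₀ - x‖ ^ 2 / a ^ 2) * (s - r) := by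
    intro r s hr hrs
    have h1 := hh.norm_sub_le_mul hφ (ha.trans_le hr) hrs hx
    rw [mul_comm] at h1
    refine h1.trans (mul_le_mul_of_nonneg_right ?_ (sub_nonneg.2 hrs))
    gcongr
  refine LipschitzOnWith.of_dist_le_mul fun r hr s hs => ?_
  rw [Real.coe_toNNReal _ (Real.sqrt_nonneg _)]
  rcases le_total r s with hrs | hrs
  · rw [dist_eq_norm, dist_comm, Real.dist_eq, abs_of_nonneg (sub_nonneg.2 hrs)]
    exact key r s hr hrs
  · rw [dist_comm, dist_eq_norm, Real.dist_eq, abs_of_nonneg (sub_nonneg.2 hrs)]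
    exact key s r hs hrs

theorem IsFlow.locallyLipschitzOn {φ : E → ℝ≥0∞} {lam : ℝ} (hφ : IsAdmissible φ lam) {u₀ : E}
    {h : ℝ → E} (hh : IsFlow φ u₀ h) : LocallyLipschitzOn (Ioi 0) h := by
  intro a ha
  obtain ⟨K, hK⟩ := hh.exists_lipschitzOnWith hφ (half_pos (mem_Ioi.1 ha))
  exact ⟨K, Ici (a / 2), mem_nhdsWithin_of_mem_nhds (Ici_mem_nhds (half_lt_self ha)), hK⟩

theorem IsFlow.locallyAC {φ : E → ℝ≥0∞} {lam : ℝ} (hφ : IsAdmissible φ lam) {u₀ : E}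
    {h : ℝ → E} (hh : IsFlow φ u₀ h) : LocallyAC h := by
  intro a b ha hab
  obtain ⟨K, hK⟩ := hh.exists_lipschitzOnWith hφ ha
  refine (hK.mono ?_).absolutelyContinuousOnInterval
  rw [uIcc_of_le hab]
  exact Icc_subset_Ici_self

end Flow

/-! ### Slopes, the evolution variational inequality, contraction and decay -/

section EVI

set_option linter.unusedSectionVars false

variable {E : Type*} [NormedAddCommGroup E] [InnerProductSpace ℝ E]

/-! ### The local slope of a convex functional -/

theorem sub_div_edist_eq {φ : E → ℝ≥0∞} {v w : E} (hv : φ v ≠ ⊤) (hw : φ w ≠ ⊤) (hne : w ≠ v) :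
    (φ v - φ w) / edist v w = ENNReal.ofReal (((φ v).toReal - (φ w).toReal) / ‖w - v‖) := by
  rw [ENNReal.ofReal_div_of_pos (norm_pos_iff.2 (sub_ne_zero.2 hne)),
    ENNReal.ofReal_sub _ ENNReal.toReal_nonneg, ENNReal.ofReal_toReal hv, ENNReal.ofReal_toReal hw,
    edist_comm, edist_dist, dist_eq_norm]

theorem slope_le_ofReal {φ : E → ℝ≥0∞} {v : E} {C : ℝ} (hv : φ v ≠ ⊤)
    (h : ∀ w, φ w ≠ ⊤ → (φ v).toReal ≤ (φ w).toReal + C * ‖w - v‖) :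
    slope φ v ≤ ENNReal.ofReal C := by
  rw [slope, if_neg hv]
  refine limsup_le_of_le (h := ?_)
  filter_upwards [self_mem_nhdsWithin] with w hw
  by_cases hw2 : φ w = ⊤
  · simp [hw2]
  · rw [sub_div_edist_eq hv hw2 hw]
    refine ENNReal.ofReal_le_ofReal ?_
    rw [div_le_iff₀ (norm_pos_iff.2 (sub_ne_zero.2 hw))]
    linarith [h w hw2]

theorem ne_top_of_slope_ne_top {φ : E → ℝ≥0∞} {v : E} (h : slope φ v ≠ ⊤) : φ v ≠ ⊤ := by
  intro hv
  exact h (by rw [slope, if_pos hv])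

/-- For a convex functional the local slope is global: the descent quotient from `v` towards `w` can
only grow as the point moves along the segment towards `v`. -/
theorem le_add_slope_mul {φ : E → ℝ≥0∞} {lam : ℝ} (hlam : 0 ≤ lam) (hconv : IsLamConvex φ lam)
    {v : E} (h : slope φ v ≠ ⊤) {w : E} (hw : φ w ≠ ⊤) :
    (φ v).toReal ≤ (φ w).toReal + (slope φ v).toReal * ‖w - v‖ := by
  have hv := ne_top_of_slope_ne_top h
  rcases eq_or_ne w v with rfl | hne
  · simp
  have hnorm : 0 < ‖w - v‖ := norm_pos_iff.2 (sub_ne_zero.2 hne)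
  suffices hs : ENNReal.ofReal (((φ v).toReal - (φ w).toReal) / ‖w - v‖) ≤ slope φ v by
    have h1 := (ENNReal.ofReal_le_iff_le_toReal h).1 hs
    rw [div_le_iff₀ hnorm] at h1
    linarith
  rw [slope, if_neg hv]
  refine le_limsup_of_frequently_le ?_
  have hc : Tendsto (fun s : ℝ => (1 - s) • v + s • w) (𝓝[>] 0) (𝓝[≠] v) := by
    refine tendsto_nhdsWithin_iff.2 ⟨?_, ?_⟩
    · have hcont : Continuous fun s : ℝ => (1 - s) • v + s • w := by fun_prop
      have := hcont.tendsto 0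
      simp only [sub_zero, one_smul, zero_smul, add_zero] at this
      exact this.mono_left nhdsWithin_le_nhds
    · filter_upwards [self_mem_nhdsWithin] with s hs
      have e : (1 - s) • v + s • w = v + s • (w - v) := by
        rw [sub_smul, smul_sub, one_smul]; abel
      rw [mem_compl_singleton_iff, e]
      intro hcon
      exact (smul_ne_zero (ne_of_gt (mem_Ioi.1 hs)) (sub_ne_zero.2 hne)) (add_eq_left.1 hcon)
  refine hc.frequently (Eventually.frequently ?_)
  filter_upwards [Ioo_mem_nhdsGT (zero_lt_one' ℝ), (tendsto_nhdsWithin_iff.1 hc).2] with s hs hs2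
  obtain ⟨h1, h2⟩ := hconv v w hv hw s hs.1.le hs.2.le
  rw [sub_div_edist_eq hv h1 hs2]
  refine ENNReal.ofReal_le_ofReal ?_
  have e : (1 - s) • v + s • w - v = s • (w - v) := by
    rw [sub_smul, smul_sub, one_smul]; abel
  rw [e, norm_smul, Real.norm_eq_abs, abs_of_pos hs.1,
    ← mul_div_mul_left _ ‖w - v‖ hs.1.ne']
  have h3 : 0 ≤ lam / 2 * (s * (1 - s)) * ‖v - w‖ ^ 2 := by
    have := hs.1
    have := sub_pos.2 hs.2
    positivity
  refine div_le_div_of_nonneg_right ?_ (mul_pos hs.1 hnorm).le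
  linarith

/-! ### Weak differentiability of Lipschitz curves -/

theorem ae_differentiableAt_of_lipschitzOnWith_Ici {f : ℝ → ℝ}
    (hf : ∀ a > 0, ∃ K, LipschitzOnWith K f (Ici a)) :
    ∀ᵐ t ∂(volume.restrict (Ioi (0 : ℝ))), DifferentiableAt ℝ f t := by
  have h1 : ∀ n : ℕ, ∀ᵐ t, t ∈ Ici (1 / ((n : ℝ) + 1)) →
      DifferentiableWithinAt ℝ f (Ici (1 / ((n : ℝ) + 1))) t := by
    intro n
    obtain ⟨K, hK⟩ := hf (1 / ((n : ℝ) + 1)) Nat.one_div_pos_of_nat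
    exact hK.ae_differentiableWithinAt_of_mem_real
  rw [ae_restrict_iff' measurableSet_Ioi]
  filter_upwards [ae_all_iff.2 h1] with t ht ht0
  obtain ⟨n, hn⟩ := exists_nat_one_div_lt (mem_Ioi.1 ht0)
  exact (ht n hn.le).differentiableAt (Ici_mem_nhds hn)

/-- The difference quotients of `inner ℝ (h s) v` are Lipschitz in `v` uniformly in `s`, so their
Cauchy property passes from `D` to its closure. -/
theorem differentiableAt_inner_of_dense {h : ℝ → E} {t : ℝ} {K : ℝ}
    (hK : ∀ᶠ s in 𝓝 t, ‖h s - h t‖ ≤ K * |s - t|) {D : Set E} (hD : Dense D)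
    (hd : ∀ e ∈ D, DifferentiableAt ℝ (fun s => inner ℝ (h s) e) t) (v : E) :
    DifferentiableAt ℝ (fun s => inner ℝ (h s) v) t := by
  have hq : ∀ᶠ s in 𝓝[≠] t, ∀ w e : E, |_root_.slope (fun s => inner ℝ (h s) w) t s
      - _root_.slope (fun s => inner ℝ (h s) e) t s| ≤ |K| * ‖w - e‖ := by
    filter_upwards [hK.filter_mono nhdsWithin_le_nhds, self_mem_nhdsWithin] with s hs hst w e
    have hpos : 0 < |s - t| := abs_pos.2 (sub_ne_zero.2 hst)
    have e1 : _root_.slope (fun s => inner ℝ (h s) w) t s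
        - _root_.slope (fun s => inner ℝ (h s) e) t s
        = inner ℝ (h s - h t) (w - e) / (s - t) := by
      simp only [slope_def_field, inner_sub_left, inner_sub_right]
      ring
    rw [e1, abs_div, div_le_iff₀ hpos]
    refine (abs_real_inner_le_norm _ _).trans ?_
    have h2 : ‖h s - h t‖ ≤ |K| * |s - t| :=
      hs.trans (mul_le_mul_of_nonneg_right (le_abs_self K) hpos.le)
    calc ‖h s - h t‖ * ‖w - e‖ ≤ (|K| * |s - t|) * ‖w - e‖ := by gcongr
      _ = |K| * ‖w - e‖ * |s - t| := by ring
  have hcau : Cauchy (map (_root_.slope (fun s => inner ℝ (h s) v) t) (𝓝[≠] t)) := by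
    rw [Metric.cauchy_iff]
    refine ⟨inferInstance, fun ε hε => ?_⟩
    obtain ⟨e, heD, he⟩ := hD.exists_dist_lt v (show 0 < ε / (4 * (|K| + 1)) by positivity)
    have hde := hasDerivAt_iff_tendsto_slope.1 (hd e heD).hasDerivAt
    have hev := (Metric.tendsto_nhds.1 hde) (ε / 4) (by positivity)
    set c := deriv (fun s => inner ℝ (h s) e) t
    have h3 : |K| * ‖v - e‖ ≤ ε / 4 := by
      rw [dist_eq_norm, lt_div_iff₀ (by positivity)] at he
      nlinarith [norm_nonneg (v - e), abs_nonneg K]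
    refine ⟨Metric.ball c (ε / 2), ?_, ?_⟩
    · rw [mem_map]
      filter_upwards [hev, hq] with s hs1 hs2
      rw [mem_preimage, Metric.mem_ball]
      have h4 := hs2 v e
      rw [← Real.dist_eq] at h4
      have := dist_triangle (_root_.slope (fun s => inner ℝ (h s) v) t s)
        (_root_.slope (fun s => inner ℝ (h s) e) t s) c
      linarith
    · intro x hx y hy
      have := dist_triangle_right x y c
      rw [Metric.mem_ball] at hx hy
      linarith
  obtain ⟨d, hd'⟩ := cauchy_map_iff_exists_tendsto.1 hcau
  exact (hasDerivAt_iff_tendsto_slope.2 hd').differentiableAt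

theorem eventually_norm_sub_le {h : ℝ → E} (hL : ∀ a > 0, ∃ K, LipschitzOnWith K h (Ici a))
    {t : ℝ} (ht : 0 < t) : ∃ K : ℝ, ∀ᶠ s in 𝓝 t, ‖h s - h t‖ ≤ K * |s - t| := by
  obtain ⟨K, hK⟩ := hL (t / 2) (half_pos ht)
  refine ⟨K, ?_⟩
  filter_upwards [Ici_mem_nhds (half_lt_self ht)] with s hs
  have := hK.dist_le_mul s hs t (half_lt_self ht).le
  rwa [dist_eq_norm, Real.dist_eq] at this

/-- Separability yields one null set valid for every `v`. Weak differentiability is all the EVI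
needs, so no strong derivative of `h` is constructed. -/
theorem ae_differentiableAt_inner [TopologicalSpace.SeparableSpace E] {h : ℝ → E}
    (hL : ∀ a > 0, ∃ K, LipschitzOnWith K h (Ici a)) :
    ∀ᵐ t ∂(volume.restrict (Ioi (0 : ℝ))), ∀ v,
      DifferentiableAt ℝ (fun s => inner ℝ (h s) v) t := by
  have h1 : ∀ n : ℕ, ∀ᵐ t ∂(volume.restrict (Ioi (0 : ℝ))),
      DifferentiableAt ℝ (fun s => inner ℝ (h s) (TopologicalSpace.denseSeq E n)) t := by
    intro n
    refine ae_differentiableAt_of_lipschitzOnWith_Ici fun a ha => ?_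
    obtain ⟨K, hK⟩ := hL a ha
    refine ⟨‖TopologicalSpace.denseSeq E n‖₊ * K, LipschitzOnWith.of_dist_le_mul fun r hr s hs => ?_⟩
    have := hK.dist_le_mul r hr s hs
    rw [Real.dist_eq, ← inner_sub_left]
    refine (abs_real_inner_le_norm _ _).trans ?_
    rw [dist_eq_norm] at this
    rw [mul_comm]
    push_cast
    rw [mul_assoc]
    gcongr
  filter_upwards [ae_all_iff.2 h1, ae_restrict_mem measurableSet_Ioi] with t ht ht0 v
  obtain ⟨K, hK⟩ := eventually_norm_sub_le hL ht0
  refine differentiableAt_inner_of_dense hK (TopologicalSpace.denseRange_denseSeq E) ?_ v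
  rintro _ ⟨n, rfl⟩
  exact ht n

theorem hasDerivAt_zero_of_le_mul {f g : ℝ → ℝ} {t : ℝ} (hf : ∀ᶠ s in 𝓝 t, |f s| ≤ g s * |s - t|)
    (hg : Tendsto g (𝓝 t) (𝓝 0)) (h0 : f t = 0) : HasDerivAt f 0 t := by
  rw [hasDerivAt_iff_tendsto_slope]
  refine squeeze_zero_norm' ?_ (hg.mono_left nhdsWithin_le_nhds)
  filter_upwards [hf.filter_mono nhdsWithin_le_nhds, self_mem_nhdsWithin] with s hs hst
  have hpos : 0 < |s - t| := abs_pos.2 (sub_ne_zero.2 hst)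
  rw [slope_def_field, h0, sub_zero, Real.norm_eq_abs, abs_div, div_le_iff₀ hpos]
  exact hs

theorem hasDerivAt_norm_sub_sq {h : ℝ → E} {t K : ℝ}
    (hK : ∀ᶠ s in 𝓝 t, ‖h s - h t‖ ≤ K * |s - t|) {v : E} {d : ℝ}
    (hd : HasDerivAt (fun s => inner ℝ (h s) (h t - v)) d t) :
    HasDerivAt (fun s => ‖h s - v‖ ^ 2) (2 * d) t := by
  have h1 : HasDerivAt (fun s => ‖h s - h t‖ ^ 2) 0 t := by
    refine hasDerivAt_zero_of_le_mul (g := fun s => K ^ 2 * |s - t|) ?_ ?_ (by simp)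
    · filter_upwards [hK] with s hs
      rw [abs_of_nonneg (sq_nonneg _)]
      calc ‖h s - h t‖ ^ 2 ≤ (K * |s - t|) ^ 2 := pow_le_pow_left₀ (norm_nonneg _) hs 2
        _ = K ^ 2 * |s - t| * |s - t| := by ring
    · have hc : Continuous fun s => K ^ 2 * |s - t| := by fun_prop
      simpa using hc.tendsto t
  have h2 := ((h1.add (hd.const_mul 2)).add_const
    (‖h t - v‖ ^ 2 - 2 * inner ℝ (h t) (h t - v)))
  rw [zero_add] at h2
  refine h2.congr_of_eventuallyEq (Eventually.of_forall fun s => ?_)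
  have e : h s - v = (h s - h t) + (h t - v) := by abel
  simp only [Pi.add_apply]
  rw [e, norm_add_sq_real, inner_sub_left]
  ring

/-! ### The evolution variational inequality -/

theorem coe_le_sub_iff {φ : E → ℝ≥0∞} {u v : E} (hv : φ v ≠ ⊤) (r : ℝ) :
    ((r : ℝ) : EReal) ≤ (φ v : EReal) - (φ u : EReal) ↔
      φ u ≠ ⊤ ∧ r ≤ (φ v).toReal - (φ u).toReal := by
  have e1 : (φ v : EReal) = (((φ v).toReal : ℝ) : EReal) := by
    rw [EReal.coe_ennreal_toReal hv]
  by_cases hu : φ u = ⊤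
  · rw [hu, e1]
    simp
  · have e2 : (φ u : EReal) = (((φ u).toReal : ℝ) : EReal) := by
      rw [EReal.coe_ennreal_toReal hu]
    rw [e1, e2, ← EReal.coe_sub, EReal.coe_le_coe_iff]
    simp [hu]

theorem IsFlow.evi_at [CompleteSpace E] {φ : E → ℝ≥0∞} {lam : ℝ} (hφ : IsAdmissible φ lam)
    {u₀ : E} {h : ℝ → E} (hh : IsFlow φ u₀ h) {t : ℝ} (ht : 0 < t)
    (hd : ∀ v, DifferentiableAt ℝ (fun s => inner ℝ (h s) v) t) {v : E} (hv : φ v ≠ ⊤) :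
    ∃ d : ℝ, HasDerivAt (fun s => ‖h s - v‖ ^ 2) d t ∧
      1 / 2 * d + lam / 2 * ‖h t - v‖ ^ 2 ≤ (φ v).toReal - (φ (h t)).toReal := by
  obtain ⟨K, hK⟩ := eventually_norm_sub_le (fun a ha => hh.exists_lipschitzOnWith hφ ha) ht
  have hfin : φ (h t) ≠ ⊤ := (hh.energy_le hφ le_rfl ht hv).1
  -- The EVI with constant `0`: let `a` increase to `t` in the energy inequality on `[a, t]`.
  have evi0 : ∀ w d, φ w ≠ ⊤ → HasDerivAt (fun s => inner ℝ (h s) (h t - w)) d t →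
      d ≤ (φ w).toReal - (φ (h t)).toReal := by
    intro w d hw hd
    have h1 := hasDerivAt_iff_tendsto_slope.1 (hasDerivAt_norm_sub_sq hK hd)
    have h2 : Tendsto (fun a => (φ w).toReal
        - _root_.slope (fun s => ‖h s - w‖ ^ 2) t a / 2) (𝓝[<] t)
        (𝓝 ((φ w).toReal - 2 * d / 2)) :=
      tendsto_const_nhds.sub ((h1.mono_left (nhdsLT_le_nhdsNE t)).div_const 2)
    have h3 : (φ (h t)).toReal ≤ (φ w).toReal - 2 * d / 2 := by
      refine ge_of_tendsto h2 ?_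
      filter_upwards [Ioo_mem_nhdsLT ht] with a ha
      refine ((hh.energy_le hφ ha.1.le ha.2 hw).2).trans (le_of_eq ?_)
      rw [slope_def_field]
      have : a - t ≠ 0 := (sub_neg.2 ha.2).ne
      have : t - a ≠ 0 := (sub_pos.2 ha.2).ne'
      rw [← neg_sub t a]
      field_simp
      ring
    linarith
  have hdv := (hd (h t - v)).hasDerivAt
  set ℓ := deriv (fun s => inner ℝ (h s) (h t - v)) t
  refine ⟨2 * ℓ, hasDerivAt_norm_sub_sq hK hdv, ?_⟩
  -- Apply `evi0` at the point at parameter `s` on the segment from `h t` to `v`: the derivative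
  -- scales by `s`, while `lam`-convexity gains `lam / 2 * s * (1 - s) * ‖h t - v‖ ^ 2`. Divide by
  -- `s` and let `s → 0`.
  have key : ℓ + lam / 2 * ‖h t - v‖ ^ 2 - ((φ v).toReal - (φ (h t)).toReal) ≤ 0 := by
    refine nonpos_of_forall_le_mul (b := lam / 2 * ‖h t - v‖ ^ 2) fun s hs hs1 => ?_
    obtain ⟨h1, h2⟩ := hφ.convex (h t) v hfin hv s hs.le hs1
    have e : h t - ((1 - s) • h t + s • v) = s • (h t - v) := by
      rw [sub_smul, smul_sub, one_smul]; abel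
    have h3 : HasDerivAt (fun r => inner ℝ (h r) (h t - ((1 - s) • h t + s • v))) (s * ℓ) t := by
      simp only [e, inner_smul_right]
      exact hdv.const_mul s
    have h4 := evi0 _ _ h1 h3
    have h5 : s * (ℓ + lam / 2 * ‖h t - v‖ ^ 2 - ((φ v).toReal - (φ (h t)).toReal))
        ≤ s * (s * (lam / 2 * ‖h t - v‖ ^ 2)) := by linarith
    exact le_of_mul_le_mul_left h5 hs
  linarith

theorem IsFlow.isEVISolution [CompleteSpace E] [TopologicalSpace.SeparableSpace E]
    {φ : E → ℝ≥0∞} {lam : ℝ} (hφ : IsAdmissible φ lam) {u₀ : E} {h : ℝ → E}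
    (hh : IsFlow φ u₀ h) : IsEVISolution φ lam u₀ h := by
  refine ⟨hh.locallyAC hφ, ?_, ?_⟩
  · have := hh.continuousOn hφ 0 self_mem_Ici
    rw [ContinuousWithinAt, hh.zero hφ] at this
    exact this
  · filter_upwards [ae_differentiableAt_inner fun a ha => hh.exists_lipschitzOnWith hφ ha,
      ae_restrict_mem measurableSet_Ioi] with t ht ht0 v hv
    obtain ⟨d, hd1, hd2⟩ := hh.evi_at hφ ht0 ht hv
    exact ⟨d, hd1, (coe_le_sub_iff hv _).2 ⟨(hh.energy_le hφ le_rfl ht0 hv).1, hd2⟩⟩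

theorem IsEVISolution.apply_zero {φ : E → ℝ≥0∞} {lam : ℝ} {u₀ : E} {h : ℝ → E}
    (hh : IsEVISolution φ lam u₀ h) : h 0 = u₀ := by
  have h1 := hh.2.1.mono_left (pure_le_nhdsWithin (mem_Ici.2 le_rfl))
  exact tendsto_nhds_unique (tendsto_pure_nhds h 0) h1

theorem _root_.AbsolutelyContinuousOnInterval.norm_sq {u : ℝ → E} {a b : ℝ}
    (hu : AbsolutelyContinuousOnInterval u a b) :
    AbsolutelyContinuousOnInterval (fun s => ‖u s‖ ^ 2) a b := by
  have h1 : AbsolutelyContinuousOnInterval (fun s => ‖u s‖) a b := by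
    refine squeeze_zero (fun t => Finset.sum_nonneg fun _ _ => dist_nonneg) (fun t => ?_) hu
    refine Finset.sum_le_sum fun i _ => ?_
    rw [Real.dist_eq, dist_eq_norm]
    exact abs_norm_sub_norm_le _ _
  have h2 := h1.mul h1
  refine (congrArg (fun f => AbsolutelyContinuousOnInterval f a b) ?_).mp h2
  ext s
  simp [pow_two]

theorem _root_.AbsolutelyContinuousOnInterval.le_of_ae_hasDerivAt_nonpos {f : ℝ → ℝ} {a b : ℝ}
    (hab : a ≤ b) (hf : AbsolutelyContinuousOnInterval f a b)
    (h : ∀ᵐ t ∂(volume.restrict (Ioc a b)), ∃ d ≤ 0, HasDerivAt f d t) : f b ≤ f a := by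
  rw [← sub_nonpos, ← hf.integral_deriv_eq_sub, intervalIntegral.integral_of_le hab]
  refine integral_nonpos_of_ae ?_
  filter_upwards [h] with t ⟨d, hd0, hd⟩
  rw [hd.deriv]
  exact hd0

/-- Test each EVI at the current position of the other curve and add: the energies cancel. Only `h`
is assumed Lipschitz, so uniqueness holds among all EVI solutions `g`. -/
theorem IsEVISolution.contraction {φ : E → ℝ≥0∞} {lam : ℝ} (hp : ∃ x, φ x ≠ ⊤) {u₀ u₁ : E}
    {g h : ℝ → E} (hg : IsEVISolution φ lam u₀ g) (hh : IsEVISolution φ lam u₁ h)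
    (hL : ∀ a > 0, ∃ K, LipschitzOnWith K h (Ici a)) {a b : ℝ} (ha : 0 < a) (hab : a ≤ b) :
    Real.exp (2 * lam * b) * ‖g b - h b‖ ^ 2 ≤ Real.exp (2 * lam * a) * ‖g a - h a‖ ^ 2 := by
  obtain ⟨x, hx⟩ := hp
  have hexp : AbsolutelyContinuousOnInterval (fun s => Real.exp (2 * lam * s)) a b := by
    refine ContDiffOn.absolutelyContinuousOnInterval (ContDiff.contDiffOn ?_)
    fun_prop
  have hac : AbsolutelyContinuousOnInterval
      (fun s => Real.exp (2 * lam * s) * ‖g s - h s‖ ^ 2) a b :=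
    hexp.mul ((hg.1 a b ha hab).sub (hh.1 a b ha hab)).norm_sq
  refine hac.le_of_ae_hasDerivAt_nonpos hab ?_
  have hsub : Ioc a b ⊆ Ioi (0 : ℝ) := fun s hs => ha.trans hs.1
  filter_upwards [ae_restrict_of_ae_restrict_of_subset hsub hg.2.2,
    ae_restrict_of_ae_restrict_of_subset hsub hh.2.2, ae_restrict_mem measurableSet_Ioc]
    with t hgt hht ht
  have ht0 : 0 < t := ha.trans ht.1
  obtain ⟨_, _, hx1⟩ := hgt x hx
  obtain ⟨_, _, hx2⟩ := hht x hx
  have hgfin : φ (g t) ≠ ⊤ := ((coe_le_sub_iff hx _).1 hx1).1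
  have hhfin : φ (h t) ≠ ⊤ := ((coe_le_sub_iff hx _).1 hx2).1
  obtain ⟨d₁, hd1, h1⟩ := hgt (h t) hhfin
  obtain ⟨d₂, hd2, h2⟩ := hht (g t) hgfin
  replace h1 := ((coe_le_sub_iff hhfin _).1 h1).2
  replace h2 := ((coe_le_sub_iff hgfin _).1 h2).2
  rw [norm_sub_rev (h t)] at h2
  -- Continuity of `g` at `t` comes from the EVI derivative for `v = g t`.
  have hgc : Tendsto (fun s => ‖g s - g t‖) (𝓝 t) (𝓝 0) := by
    obtain ⟨d, hd, -⟩ := hgt (g t) hgfin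
    have := hd.continuousAt.tendsto.sqrt
    simpa [Real.sqrt_sq_eq_abs] using this
  obtain ⟨K, hK⟩ := eventually_norm_sub_le hL ht0
  -- The mixed term in the expansion of `‖g s - h s‖ ^ 2` is `o(|s - t|)`: one factor tends to zero
  -- and the other is Lipschitz. Hence the two partial derivatives add.
  have h3 : HasDerivAt (fun s => inner ℝ (g s - g t) (h s - h t)) 0 t := by
    refine hasDerivAt_zero_of_le_mul (g := fun s => ‖g s - g t‖ * K) ?_ ?_ (by simp)
    · filter_upwards [hK] with s hs
      refine (abs_real_inner_le_norm _ _).trans ?_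
      rw [mul_assoc]
      gcongr
    · simpa using hgc.mul_const K
  have h4 : HasDerivAt (fun s => ‖g s - h s‖ ^ 2) (d₁ + d₂) t := by
    have h5 := ((hd1.add hd2).sub_const (‖g t - h t‖ ^ 2)).sub (h3.const_mul 2)
    rw [mul_zero, sub_zero] at h5
    refine h5.congr_of_eventuallyEq (Eventually.of_forall fun s => ?_)
    have e : g s - h s = ((g t - h t) + (g s - g t)) - (h s - h t) := by abel
    have e1 : g s - h t = (g t - h t) + (g s - g t) := by abel
    have e2 : h s - g t = (h s - h t) - (g t - h t) := by abel
    simp only [Pi.add_apply, Pi.sub_apply]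
    rw [e, e1, e2, norm_sub_sq_real (_ + _), norm_add_sq_real, inner_add_left,
      norm_sub_sq_real (h s - h t), real_inner_comm (h s - h t) (g t - h t)]
    ring
  have h6 : HasDerivAt (fun s => Real.exp (2 * lam * s)) (Real.exp (2 * lam * t) * (2 * lam)) t := by
    have := ((hasDerivAt_id t).const_mul (2 * lam)).exp
    simpa using this
  refine ⟨_, ?_, h6.mul h4⟩
  have h7 : Real.exp (2 * lam * t) * (2 * lam) * ‖g t - h t‖ ^ 2
      + Real.exp (2 * lam * t) * (d₁ + d₂)
      = Real.exp (2 * lam * t) * (2 * lam * ‖g t - h t‖ ^ 2 + (d₁ + d₂)) := by ring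
  rw [h7]
  exact mul_nonpos_of_nonneg_of_nonpos (Real.exp_pos _).le (by linarith)

theorem IsEVISolution.contraction_zero {φ : E → ℝ≥0∞} {lam : ℝ} (hp : ∃ x, φ x ≠ ⊤) {u₀ u₁ : E}
    {g h : ℝ → E} (hg : IsEVISolution φ lam u₀ g) (hh : IsEVISolution φ lam u₁ h)
    (hL : ∀ a > 0, ∃ K, LipschitzOnWith K h (Ici a)) {a b : ℝ} (ha : 0 ≤ a) (hab : a ≤ b) :
    Real.exp (2 * lam * b) * ‖g b - h b‖ ^ 2 ≤ Real.exp (2 * lam * a) * ‖g a - h a‖ ^ 2 := by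
  rcases ha.eq_or_lt with rfl | ha
  · rcases hab.eq_or_lt with rfl | hb
    · exact le_rfl
    have h1 : Tendsto (fun s => Real.exp (2 * lam * s) * ‖g s - h s‖ ^ 2) (𝓝[>] 0)
        (𝓝 (Real.exp (2 * lam * 0) * ‖g 0 - h 0‖ ^ 2)) := by
      rw [hg.apply_zero, hh.apply_zero]
      have hle : 𝓝[>] (0 : ℝ) ≤ 𝓝[≥] 0 := nhdsWithin_mono _ Ioi_subset_Ici_self
      refine Tendsto.mul ?_ ((((hg.2.1.mono_left hle).sub (hh.2.1.mono_left hle)).norm).pow 2)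
      have hc : Continuous fun s : ℝ => Real.exp (2 * lam * s) := by fun_prop
      exact (hc.tendsto 0).mono_left nhdsWithin_le_nhds
    refine ge_of_tendsto h1 ?_
    filter_upwards [Ioo_mem_nhdsGT hb] with s hs
    exact hg.contraction hp hh hL hs.1 hs.2.le
  · exact hg.contraction hp hh hL ha hab

theorem IsEVISolution.eqOn {φ : E → ℝ≥0∞} {lam : ℝ} (hp : ∃ x, φ x ≠ ⊤) {u₀ : E}
    {g h : ℝ → E} (hg : IsEVISolution φ lam u₀ g) (hh : IsEVISolution φ lam u₀ h)
    (hL : ∀ a > 0, ∃ K, LipschitzOnWith K h (Ici a)) : EqOn g h (Ici 0) := by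
  intro b hb
  have h1 := hg.contraction_zero hp hh hL le_rfl (mem_Ici.1 hb)
  rw [hg.apply_zero, hh.apply_zero, sub_self, norm_zero, zero_pow two_ne_zero, mul_zero] at h1
  have h2 : ‖g b - h b‖ ^ 2 ≤ 0 := by
    by_contra hcon
    exact absurd h1 (not_le.2 (mul_pos (Real.exp_pos _) (not_le.1 hcon)))
  have h3 : ‖g b - h b‖ = 0 := pow_eq_zero_iff two_ne_zero |>.1 (le_antisymm h2 (sq_nonneg _))
  exact sub_eq_zero.1 (norm_eq_zero.1 h3)

/-- A point minimizing `φ` with quadratic growth is a stationary solution. -/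
theorem isEVISolution_const {φ : E → ℝ≥0∞} {lam : ℝ} {z : E} (hz : φ z ≠ ⊤)
    (hmin : ∀ u, φ u ≠ ⊤ → (φ z).toReal + lam / 2 * ‖u - z‖ ^ 2 ≤ (φ u).toReal) :
    IsEVISolution φ lam z (fun _ => z) := by
  refine ⟨fun a b _ _ => (LipschitzWith.const z).lipschitzOnWith.absolutelyContinuousOnInterval,
    tendsto_const_nhds, Eventually.of_forall fun t v hv => ⟨0, hasDerivAt_const _ _, ?_⟩⟩
  rw [coe_le_sub_iff hv]
  refine ⟨hz, ?_⟩
  rw [norm_sub_rev]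
  linarith [hmin v hv]

theorem IsFlow.slope_sq_le [CompleteSpace E] {φ : E → ℝ≥0∞} {lam : ℝ} (hφ : IsAdmissible φ lam)
    {u₀ : E} {h : ℝ → E} (hh : IsFlow φ u₀ h) {t : ℝ} (ht : 0 < t) {v : E}
    (hv : slope φ v ≠ ⊤) :
    slope φ (h t) ^ 2 ≤ slope φ v ^ 2 + ENNReal.ofReal (1 / t ^ 2 * ‖v - u₀‖ ^ 2) := by
  have hv' := ne_top_of_slope_ne_top hv
  have hS := fun w hw => le_add_slope_mul hφ.nonneg hφ.convex hv (w := w) hw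
  have h1 := slope_le_ofReal (hh.energy_le hφ le_rfl ht hv').1
    fun w hw => hh.energy_le_add_mul hφ ht hv' hS hw
  refine (pow_le_pow_left₀ zero_le h1 2).trans (le_of_eq ?_)
  rw [← ENNReal.ofReal_pow (Real.sqrt_nonneg _), Real.sq_sqrt (by positivity),
    ENNReal.ofReal_add (by positivity) (by positivity),
    ENNReal.ofReal_pow ENNReal.toReal_nonneg, ENNReal.ofReal_toReal hv, norm_sub_rev,
    one_div_mul_eq_div]

theorem IsFlow.energy_le_add [CompleteSpace E] {φ : E → ℝ≥0∞} {lam : ℝ} (hφ : IsAdmissible φ lam)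
    {u₀ : E} {h : ℝ → E} (hh : IsFlow φ u₀ h) {t : ℝ} (ht : 0 < t) {v : E} (hv : φ v ≠ ⊤) :
    φ (h t) ≤ φ v + ENNReal.ofReal (1 / (2 * t) * ‖v - u₀‖ ^ 2) := by
  obtain ⟨h1, h2⟩ := hh.energy_le hφ le_rfl ht hv
  rw [hh.zero hφ, sub_zero] at h2
  have h3 : (φ (h t)).toReal ≤ (φ v).toReal + 1 / (2 * t) * ‖v - u₀‖ ^ 2 := by
    refine h2.trans (add_le_add le_rfl ?_)
    rw [norm_sub_rev u₀, div_le_iff₀ ht]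
    have e : 1 / (2 * t) * ‖v - u₀‖ ^ 2 * t = ‖v - u₀‖ ^ 2 / 2 := by field_simp
    rw [e]
    linarith [sq_nonneg ‖h t - v‖]
  rw [← ENNReal.ofReal_toReal h1, ← ENNReal.ofReal_toReal hv,
    ← ENNReal.ofReal_add ENNReal.toReal_nonneg (by positivity)]
  exact ENNReal.ofReal_le_ofReal h3

theorem IsFlow.decay [CompleteSpace E] [TopologicalSpace.SeparableSpace E] {φ : E → ℝ≥0∞}
    {lam : ℝ} (hφ : IsAdmissible φ lam) {u₀ : E} {h : ℝ → E} (hh : IsFlow φ u₀ h) {z : E}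
    (hz : φ z ≠ ⊤)
    (hmin : ∀ u, φ u ≠ ⊤ → (φ z).toReal + lam / 2 * ‖u - z‖ ^ 2 ≤ (φ u).toReal)
    {t₀ t : ℝ} (ht₀ : 0 ≤ t₀) (ht : t₀ ≤ t) :
    ENNReal.ofReal (lam / 2 * ‖h t - z‖ ^ 2)
      ≤ (φ (h t₀) - φ z) * ENNReal.ofReal (Real.exp (-2 * lam * (t - t₀))) := by
  by_cases hfin : φ (h t₀) = ⊤
  · rw [hfin, ENNReal.top_sub hz, ENNReal.top_mul]
    · exact le_top
    · exact (ENNReal.ofReal_pos.2 (Real.exp_pos _)).ne'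
  -- Contraction towards the stationary solution `z`; quadratic growth is then used once, at time
  -- `t₀`, to replace squared distance by energy.
  have h1 := (hh.isEVISolution hφ).contraction_zero ⟨z, hz⟩ (isEVISolution_const hz hmin)
    (fun a _ => ⟨0, (LipschitzWith.const z).lipschitzOnWith⟩) ht₀ ht
  have h2 := hmin _ hfin
  rw [← ENNReal.ofReal_toReal hfin, ← ENNReal.ofReal_toReal hz,
    ← ENNReal.ofReal_sub _ ENNReal.toReal_nonneg, ← ENNReal.ofReal_mul (by
      have : 0 ≤ lam / 2 * ‖h t₀ - z‖ ^ 2 := by have := hφ.nonneg; positivity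
      linarith)]
  refine ENNReal.ofReal_le_ofReal ?_
  have h3 : ‖h t - z‖ ^ 2 ≤ ‖h t₀ - z‖ ^ 2 * Real.exp (-2 * lam * (t - t₀)) := by
    have e : Real.exp (-2 * lam * (t - t₀)) = Real.exp (2 * lam * t₀) / Real.exp (2 * lam * t) := by
      rw [← Real.exp_sub]; ring_nf
    rw [e, ← mul_div_assoc, le_div_iff₀ (Real.exp_pos _)]
    linarith
  calc lam / 2 * ‖h t - z‖ ^ 2
      ≤ lam / 2 * (‖h t₀ - z‖ ^ 2 * Real.exp (-2 * lam * (t - t₀))) :=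
        mul_le_mul_of_nonneg_left h3 (by have := hφ.nonneg; positivity)
    _ = (lam / 2 * ‖h t₀ - z‖ ^ 2) * Real.exp (-2 * lam * (t - t₀)) := by ring
    _ ≤ _ := mul_le_mul_of_nonneg_right (by linarith) (Real.exp_pos _).le

end EVI

/-! ### Weak derivatives, Fourier coefficients and the Poincaré inequality on the circle -/

section Circle

set_option linter.unusedSectionVars false

variable {L : ℝ} [Fact (0 < L)]

instance separableSpace_H : TopologicalSpace.SeparableSpace (H L) := by
  have : Fact ((2 : ℝ≥0∞) ≠ ⊤) := ⟨ENNReal.ofNat_ne_top⟩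
  have : SecondCountableTopology (L2 L) := inferInstance
  infer_instance

/-- The class in `L²` of a continuous function on the circle. -/
def ofCont (f : C(AddCircle L, ℝ)) : L2 L := ContinuousMap.toLp 2 volume ℝ f

theorem coeFn_ofCont (f : C(AddCircle L, ℝ)) : ofCont f =ᵐ[volume] f :=
  ContinuousMap.coeFn_toLp volume f

theorem inner_ofCont (f : C(AddCircle L, ℝ)) (u : L2 L) :
    inner ℝ (ofCont f) u = ∫ x, u x * f x := by
  rw [L2.inner_def]
  refine integral_congr_ae ?_
  filter_upwards [coeFn_ofCont f] with x hx
  rw [hx]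
  simp

theorem norm_sq_eq_integral (u : L2 L) : ‖u‖ ^ 2 = ∫ x, u x ^ 2 := by
  rw [← real_inner_self_eq_norm_sq, L2.inner_def]
  refine integral_congr_ae (Eventually.of_forall fun x => ?_)
  simp [pow_two]

theorem integrable_L2 (u : L2 L) : Integrable u volume := (Lp.memLp u).integrable one_le_two

theorem integrable_sq_L2 (u : L2 L) : Integrable (fun x => u x ^ 2) volume :=
  (Lp.memLp u).integrable_sq

theorem integral_H (u : H L) : ∫ x, (u : L2 L) x = 0 := u.2

theorem isClosed_meanZero : IsClosed (meanZero L : Set (L2 L)) := by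
  have h : (meanZero L : Set (L2 L)) = (fun u => inner ℝ (ofCont (1 : C(AddCircle L, ℝ))) u) ⁻¹' {0} := by
    ext u
    rw [mem_preimage, inner_ofCont, mem_singleton_iff]
    simp only [ContinuousMap.one_apply, mul_one]
    rfl
  rw [h]
  exact isClosed_singleton.preimage (by fun_prop)

instance completeSpace_H : CompleteSpace (H L) := isClosed_meanZero.completeSpace_coe

/-! ### Test functions and weak derivatives -/

/-- `ψ` is a smooth function on the circle with derivative `ψ'`. -/
def IsTest (ψ ψ' : C(AddCircle L, ℝ)) : Prop :=
  ContDiff ℝ (⊤ : ℕ∞) (fun x : ℝ => ψ x) ∧ ∀ x : ℝ, HasDerivAt (fun y : ℝ => ψ y) (ψ' x) x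

theorem continuous_of_comp_coe {f : AddCircle L → ℝ} (h : Continuous fun x : ℝ => f x) :
    Continuous f :=
  (QuotientAddGroup.isQuotientMap_mk (AddSubgroup.zmultiples L)).continuous_iff.2 h

/-- In terms of inner products with continuous functions the relation is visibly linear and closed.
Continuity of `ψ` and `ψ'` descends from the line through the quotient map. -/
theorem isWeakDeriv_iff {u g : L2 L} : IsWeakDeriv u g ↔
    ∀ ψ ψ' : C(AddCircle L, ℝ), IsTest ψ ψ' →
      inner ℝ (ofCont ψ') u = - inner ℝ (ofCont ψ) g := by
  constructor
  · intro h ψ ψ' hψ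
    rw [inner_ofCont, inner_ofCont]
    exact h ψ ψ' hψ.1 hψ.2
  · intro h ψ ψ' hψ hψ'
    have hc : Continuous ψ := continuous_of_comp_coe hψ.continuous
    have hc' : Continuous ψ' := by
      refine continuous_of_comp_coe ?_
      have e : (fun x : ℝ => ψ' x) = deriv fun x : ℝ => ψ x := by
        ext x
        exact (hψ' x).deriv.symm
      rw [e]
      exact hψ.continuous_deriv (by simp)
    have := h ⟨ψ, hc⟩ ⟨ψ', hc'⟩ ⟨hψ, hψ'⟩
    rwa [inner_ofCont, inner_ofCont] at this

theorem IsWeakDeriv.combo {u g v k : L2 L} (h : IsWeakDeriv u g) (h' : IsWeakDeriv v k) (a b : ℝ) :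
    IsWeakDeriv (a • u + b • v) (a • g + b • k) := by
  rw [isWeakDeriv_iff] at *
  intro ψ ψ' hψ
  simp only [inner_add_right, inner_smul_right, h ψ ψ' hψ, h' ψ ψ' hψ]
  ring

theorem IsWeakDeriv.sub {u g v k : L2 L} (h : IsWeakDeriv u g) (h' : IsWeakDeriv v k) :
    IsWeakDeriv (u - v) (g - k) := by
  have := h.combo h' 1 (-1)
  simpa [sub_eq_add_neg] using this

theorem isWeakDeriv_zero : IsWeakDeriv (0 : L2 L) 0 := by
  rw [isWeakDeriv_iff]
  simp

theorem IsWeakDeriv.of_tendsto {u g : ℕ → L2 L} {v k : L2 L} (h : ∀ n, IsWeakDeriv (u n) (g n))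
    (hu : Tendsto u atTop (𝓝 v)) (hg : Tendsto g atTop (𝓝 k)) : IsWeakDeriv v k := by
  rw [isWeakDeriv_iff]
  intro ψ ψ' hψ
  have h1 : Tendsto (fun n => inner ℝ (ofCont ψ') (u n)) atTop (𝓝 (inner ℝ (ofCont ψ') v)) :=
    tendsto_const_nhds.inner hu
  have h2 : Tendsto (fun n => - inner ℝ (ofCont ψ) (g n)) atTop (𝓝 (- inner ℝ (ofCont ψ) k)) :=
    (tendsto_const_nhds.inner hg).neg
  exact tendsto_nhds_unique h1 (h2.congr fun n => (isWeakDeriv_iff.1 (h n) ψ ψ' hψ).symm)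

theorem IsTest.integral_eq_zero {F F' : C(AddCircle L, ℝ)} (h : IsTest F F') :
    ∫ x, F' x = 0 := by
  rw [← AddCircle.intervalIntegral_preimage L 0, intervalIntegral.integral_eq_sub_of_hasDerivAt
    (fun x _ => h.2 x) ((F'.continuous.comp (AddCircle.continuous_mk' L)).intervalIntegrable _ _)]
  simp [AddCircle.coe_period L]

theorem IsTest.mul {f f' g g' : C(AddCircle L, ℝ)} (hf : IsTest f f') (hg : IsTest g g') :
    IsTest (f * g) (f' * g + f * g') :=
  ⟨hf.1.mul hg.1, fun x => (hf.2 x).mul (hg.2 x)⟩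

theorem IsTest.isWeakDeriv {f f' : C(AddCircle L, ℝ)} (hf : IsTest f f') :
    IsWeakDeriv (ofCont f) (ofCont f') := by
  rw [isWeakDeriv_iff]
  intro ψ ψ' hψ
  have h := (hf.mul hψ).integral_eq_zero
  have hint : ∀ k : C(AddCircle L, ℝ), Integrable k (volume : Measure (AddCircle L)) := fun k =>
    k.continuous.integrable_of_hasCompactSupport (HasCompactSupport.of_compactSpace _)
  have e : ∀ k l : C(AddCircle L, ℝ), inner ℝ (ofCont k) (ofCont l) = ∫ x, (l * k) x := by
    intro k l
    rw [inner_ofCont]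
    refine integral_congr_ae ?_
    filter_upwards [coeFn_ofCont l] with x hx
    rw [hx]
    rfl
  have h2 : ∫ x, (f' * ψ + f * ψ') x = (∫ x, (f' * ψ) x) + ∫ x, (f * ψ') x :=
    integral_add (hint (f' * ψ)) (hint (f * ψ'))
  rw [e, e]
  linarith

/-! ### Trigonometric functions and Fourier coefficients -/

/-- The real trigonometric function `Re (a e^{2πinx/L})`. -/
def trig (a : ℂ) (n : ℤ) : C(AddCircle L, ℝ) :=
  ⟨fun x => (a * fourier n x).re,
    Complex.continuous_re.comp (continuous_const.mul (map_continuous (fourier n)))⟩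

theorem trig_apply (a : ℂ) (n : ℤ) (x : AddCircle L) : trig a n x = (a * fourier n x).re := rfl

variable (L) in
/-- The frequency `2πin/L`. -/
def freq (n : ℤ) : ℂ := 2 * Real.pi * Complex.I * n / L

theorem isTest_trig (a : ℂ) (n : ℤ) :
    IsTest (trig a n : C(AddCircle L, ℝ)) (trig (a * freq L n) n) := by
  constructor
  · have e : (fun x : ℝ => (trig a n : C(AddCircle L, ℝ)) x) = fun x : ℝ =>
        Complex.reCLM (a * Complex.exp (2 * Real.pi * Complex.I * n * Complex.ofRealCLM x / L)) := by
      ext x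
      rw [trig_apply, fourier_coe_apply]
      rfl
    rw [e]
    refine Complex.reCLM.contDiff.comp ?_
    have h1 : ContDiff ℝ (⊤ : ℕ∞) fun x : ℝ =>
        2 * Real.pi * Complex.I * n * Complex.ofRealCLM x / L :=
      (contDiff_const.mul Complex.ofRealCLM.contDiff).div_const _
    exact contDiff_const.mul h1.cexp
  · intro x
    have h := ((hasDerivAt_fourier L n x).const_mul a)
    have h2 := Complex.reCLM.hasFDerivAt.comp_hasDerivAt x h
    rw [show (trig (a * freq L n) n : C(AddCircle L, ℝ)) (x : AddCircle L) = Complex.reCLM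
      (a * (2 * Real.pi * Complex.I * n / L * fourier n (x : AddCircle L))) from ?_]
    · exact h2
    · rw [trig_apply, freq, mul_assoc]
      rfl

/-- The Fourier coefficient `∫ u(x) e^{2πinx/L} dx`. -/
def fint (u : L2 L) (n : ℤ) : ℂ := ∫ x, (u x : ℂ) * fourier n x

theorem integrable_mul_fourier (u : L2 L) (n : ℤ) :
    Integrable (fun x => (u x : ℂ) * fourier n x) volume := by
  refine (integrable_L2 u).ofReal.mul_bdd (c := 1) (map_continuous (fourier n)).aestronglyMeasurable ?_
  refine Eventually.of_forall fun x => ?_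
  rw [fourier_apply, Circle.norm_coe]

theorem inner_trig (a : ℂ) (n : ℤ) (u : L2 L) :
    inner ℝ (ofCont (trig a n)) u = (a * fint u n).re := by
  rw [inner_ofCont, fint, ← integral_const_mul]
  have h := Complex.reCLM.integral_comp_comm ((integrable_mul_fourier u n).const_mul a)
  rw [← Complex.reCLM_apply, ← h]
  refine integral_congr_ae (Eventually.of_forall fun x => ?_)
  simp only [Complex.reCLM_apply]
  rw [trig_apply, ← Complex.re_ofReal_mul]
  congr 1
  ring

/-- The complexification of a real `L²` function, with respect to the Haar probability measure. -/
theorem memLp_ofReal (u : L2 L) :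
    MemLp (fun x => (u x : ℂ)) 2 (AddCircle.haarAddCircle : Measure (AddCircle L)) :=
  (Lp.memLp u).ofReal.haarAddCircle

theorem fourierCoeff_toLp_ofReal (u : L2 L) (n : ℤ) :
    fourierCoeff (memLp_ofReal u).toLp n = L⁻¹ • fint u (-n) := by
  rw [fourierCoeff_congr_ae (memLp_ofReal u).coeFn_toLp, fourierCoeff,
    AddCircle.integral_haarAddCircle, fint]
  simp only [smul_eq_mul, mul_comm]

theorem integral_norm_sq_toLp_ofReal (u : L2 L) :
    ∫ t, ‖(memLp_ofReal u).toLp (fun x => (u x : ℂ)) t‖ ^ 2 ∂AddCircle.haarAddCircle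
      = L⁻¹ * ‖u‖ ^ 2 := by
  have h := AddCircle.integral_haarAddCircle (T := L) (f := fun x => u x ^ 2)
  rw [norm_sq_eq_integral u, ← smul_eq_mul, ← h]
  refine integral_congr_ae ?_
  filter_upwards [(memLp_ofReal u).coeFn_toLp] with x hx
  rw [hx]
  simp

/-- Parseval's identity. -/
theorem hasSum_fint (u : L2 L) : HasSum (fun n => ‖fint u n‖ ^ 2) (L * ‖u‖ ^ 2) := by
  have hL : 0 < L := Fact.out
  have h := (hasSum_sq_fourierCoeff (memLp_ofReal u).toLp).mul_left (L ^ 2)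
  rw [integral_norm_sq_toLp_ofReal] at h
  have e : L * ‖u‖ ^ 2 = L ^ 2 * (L⁻¹ * ‖u‖ ^ 2) := by field_simp
  -- `fint` uses the character `e^{+2πinx/L}`, so it is `L` times the Fourier coefficient of index
  -- `-n`; hence the reindexing.
  rw [← (Equiv.neg ℤ).hasSum_iff, e]
  refine (congrArg (fun f => HasSum f (L ^ 2 * (L⁻¹ * ‖u‖ ^ 2))) (funext fun n => ?_)).mp h
  rw [fourierCoeff_toLp_ofReal, norm_smul, mul_pow, norm_inv, Real.norm_eq_abs, abs_of_pos hL,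
    ← mul_assoc, ← mul_pow, mul_inv_cancel₀ hL.ne', one_pow, one_mul]
  rfl

theorem eq_zero_of_fint {u : L2 L} (h : ∀ n, fint u n = 0) : u = 0 := by
  have hL : 0 < L := Fact.out
  have h1 := hasSum_fint u
  simp only [h, norm_zero, ne_eq, OfNat.ofNat_ne_zero, not_false_eq_true, zero_pow] at h1
  have h2 := h1.unique hasSum_zero
  have h3 : ‖u‖ ^ 2 = 0 := (mul_eq_zero.1 h2).resolve_left hL.ne'
  exact norm_eq_zero.1 (pow_eq_zero_iff two_ne_zero |>.1 h3)

theorem fint_zero (n : ℤ) : fint (0 : L2 L) n = 0 := by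
  have h1 := hasSum_fint (0 : L2 L)
  rw [norm_zero, zero_pow two_ne_zero, mul_zero] at h1
  have := (hasSum_zero_iff_of_nonneg fun n => by positivity).1 h1
  have h2 := congrFun this n
  exact norm_eq_zero.1 (pow_eq_zero_iff two_ne_zero |>.1 h2)

theorem fint_index_zero (u : L2 L) : fint u 0 = ((∫ x, u x : ℝ) : ℂ) := by
  rw [fint]
  simp only [fourier_zero, mul_one]
  exact integral_ofReal

theorem IsWeakDeriv.fint_eq {u g : L2 L} (h : IsWeakDeriv u g) (n : ℤ) :
    fint g n = -(freq L n * fint u n) := by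
  -- Test functions are real, so only real parts are available; the factors `a = 1` and `a = I`
  -- recover the complex identity.
  have key : ∀ a : ℂ, (a * (freq L n * fint u n + fint g n)).re = 0 := by
    intro a
    have h1 := isWeakDeriv_iff.1 h _ _ (isTest_trig a n)
    rw [inner_trig, inner_trig] at h1
    rw [mul_add, Complex.add_re, ← mul_assoc, h1]
    ring
  set z := freq L n * fint u n + fint g n
  have hz : z = 0 := by
    refine Complex.ext ?_ ?_
    · simpa using key 1
    · simpa using key Complex.I
  exact eq_neg_of_add_eq_zero_right hz

theorem norm_freq (n : ℤ) : ‖freq L n‖ = 2 * Real.pi / L * |(n : ℝ)| := by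
  have hL : 0 < L := Fact.out
  rw [freq]
  simp [abs_of_pos hL, abs_of_pos Real.pi_pos]
  ring

theorem IsWeakDeriv.unique {u g g' : L2 L} (h : IsWeakDeriv u g) (h' : IsWeakDeriv u g') :
    g = g' := by
  have h1 := h.sub h'
  rw [sub_self] at h1
  refine sub_eq_zero.1 (eq_zero_of_fint fun n => ?_)
  rw [h1.fint_eq, fint_zero, mul_zero, neg_zero]

theorem IsWeakDeriv.integral_eq_zero {u g : L2 L} (h : IsWeakDeriv u g) : ∫ x, g x = 0 := by
  have h1 := h.fint_eq 0
  rw [fint_index_zero] at h1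
  simpa [freq] using h1

/-- Wirtinger's inequality. -/
theorem IsWeakDeriv.wirtinger {u g : L2 L} (h : IsWeakDeriv u g) (hu : ∫ x, u x = 0) :
    (2 * Real.pi / L) ^ 2 * ‖u‖ ^ 2 ≤ ‖g‖ ^ 2 := by
  have hL : 0 < L := Fact.out
  have h1 := (hasSum_fint u).mul_left ((2 * Real.pi / L) ^ 2)
  have h2 := hasSum_fint g
  have h3 : (2 * Real.pi / L) ^ 2 * (L * ‖u‖ ^ 2) ≤ L * ‖g‖ ^ 2 := by
    refine hasSum_le (fun n => ?_) h1 h2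
    -- The zero mode, which differentiation kills, is absent because `u` has mean zero.
    rcases eq_or_ne n 0 with rfl | hn
    · rw [fint_index_zero, hu]
      simp
    · rw [h.fint_eq, norm_neg, norm_mul, norm_freq, mul_pow, mul_pow _ |(n : ℝ)|]
      have hn1 : (1 : ℝ) ≤ |(n : ℝ)| := by exact_mod_cast Int.one_le_abs hn
      have hn2 : (1 : ℝ) ≤ |(n : ℝ)| ^ 2 := one_le_pow₀ hn1
      have : 0 ≤ (2 * Real.pi / L) ^ 2 * ‖fint u n‖ ^ 2 := by positivity
      nlinarith
  have h4 : L * ((2 * Real.pi / L) ^ 2 * ‖u‖ ^ 2) ≤ L * ‖g‖ ^ 2 := by linarith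
  exact le_of_mul_le_mul_left h4 hL

theorem IsWeakSecondDeriv.unique {u w w' : L2 L} (h : IsWeakSecondDeriv u w)
    (h' : IsWeakSecondDeriv u w') : w = w' := by
  obtain ⟨g, hg, hw⟩ := h
  obtain ⟨g', hg', hw'⟩ := h'
  obtain rfl := hg.unique hg'
  exact hw.unique hw'

theorem IsWeakSecondDeriv.combo {u w v z : L2 L} (h : IsWeakSecondDeriv u w)
    (h' : IsWeakSecondDeriv v z) (a b : ℝ) :
    IsWeakSecondDeriv (a • u + b • v) (a • w + b • z) := by
  obtain ⟨g, hg, hw⟩ := h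
  obtain ⟨k, hk, hz⟩ := h'
  exact ⟨_, hg.combo hk a b, hw.combo hz a b⟩

theorem IsWeakSecondDeriv.sub {u w v z : L2 L} (h : IsWeakSecondDeriv u w)
    (h' : IsWeakSecondDeriv v z) : IsWeakSecondDeriv (u - v) (w - z) := by
  obtain ⟨g, hg, hw⟩ := h
  obtain ⟨k, hk, hz⟩ := h'
  exact ⟨_, hg.sub hk, hw.sub hz⟩

theorem isWeakSecondDeriv_zero : IsWeakSecondDeriv (0 : L2 L) 0 :=
  ⟨0, isWeakDeriv_zero, isWeakDeriv_zero⟩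

theorem rate_pos : 0 < rate L := by
  have hL : 0 < L := Fact.out
  have := Real.pi_pos
  unfold rate
  positivity

/-- Wirtinger's inequality applies to `u` and again to its derivative, since every weak derivative
has mean zero. This is the origin of the fourth power in `rate`. -/
theorem IsWeakSecondDeriv.poincare {u : H L} {w : L2 L} (h : IsWeakSecondDeriv (u : L2 L) w) :
    rate L * ‖u‖ ^ 2 ≤ ‖w‖ ^ 2 := by
  obtain ⟨g, hg, hw⟩ := h
  have h1 := hg.wirtinger (integral_H u)
  have h2 := hw.wirtinger hg.integral_eq_zero
  have h3 : rate L * ‖(u : L2 L)‖ ^ 2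
      = (2 * Real.pi / L) ^ 2 * ((2 * Real.pi / L) ^ 2 * ‖(u : L2 L)‖ ^ 2) := by
    unfold rate; ring
  change rate L * ‖(u : L2 L)‖ ^ 2 ≤ ‖w‖ ^ 2
  rw [h3]
  exact (mul_le_mul_of_nonneg_left h1 (by positivity)).trans h2

theorem cauchySeq_of_sq_le {A B : Type*} [SeminormedAddCommGroup A] [SeminormedAddCommGroup B]
    {c : ℝ} (hc : 0 < c)
    {x : ℕ → A} {y : ℕ → B} (hy : CauchySeq y) (h : ∀ n m, c * ‖x n - x m‖ ^ 2 ≤ ‖y n - y m‖ ^ 2) :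
    CauchySeq x := by
  rw [Metric.cauchySeq_iff] at *
  intro ε hε
  obtain ⟨N, hN⟩ := hy (√c * ε) (mul_pos (Real.sqrt_pos.2 hc) hε)
  refine ⟨N, fun m hm n hn => ?_⟩
  have h1 := hN m hm n hn
  rw [dist_eq_norm] at *
  have h2 : (√c * ‖x m - x n‖) ^ 2 ≤ ‖y m - y n‖ ^ 2 := by
    rw [mul_pow, Real.sq_sqrt hc.le]; exact h m n
  have h3 := (pow_le_pow_iff_left₀ (by positivity) (norm_nonneg _) two_ne_zero).1 h2
  exact lt_of_mul_lt_mul_left (h3.trans_lt h1) (Real.sqrt_nonneg c)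

/-- On mean-zero functions, convergence of the second derivatives implies convergence of the
functions, and the second derivative passes to the limit. -/
theorem IsWeakSecondDeriv.exists_of_tendsto {v : ℕ → H L} {w : ℕ → L2 L} {z : L2 L}
    (h : ∀ n, IsWeakSecondDeriv (v n : L2 L) (w n)) (hw : Tendsto w atTop (𝓝 z)) :
    ∃ u : H L, Tendsto v atTop (𝓝 u) ∧ IsWeakSecondDeriv (u : L2 L) z := by
  have hL : 0 < L := Fact.out
  have hpi := Real.pi_pos
  have hv : CauchySeq v := by
    refine cauchySeq_of_sq_le (rate_pos (L := L)) hw.cauchySeq fun n m => ?_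
    have h1 : IsWeakSecondDeriv ((v n - v m : H L) : L2 L) (w n - w m) := (h n).sub (h m)
    exact h1.poincare
  choose g hg hgw using h
  have hgc : CauchySeq g := by
    refine cauchySeq_of_sq_le (c := (2 * Real.pi / L) ^ 2) (by positivity) hw.cauchySeq
      fun n m => ?_
    exact ((hgw n).sub (hgw m)).wirtinger ((hg n).sub (hg m)).integral_eq_zero
  obtain ⟨u, hu⟩ := cauchySeq_tendsto_of_complete hv
  obtain ⟨k, hk⟩ := cauchySeq_tendsto_of_complete hgc
  refine ⟨u, hu, k, ?_, IsWeakDeriv.of_tendsto hgw hk hw⟩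
  exact IsWeakDeriv.of_tendsto (u := fun n => (v n : L2 L)) hg ((continuous_subtype_val.tendsto u).comp hu) hk

end Circle

/-! ### Convexity, lower semicontinuity and dense domain of the energy -/

section Energy

set_option linter.unusedSectionVars false

/-- The second derivative is `cosh - 1 ≥ 0`. This is the only source of quantitative convexity. -/
theorem convexOn_cosh_sub_sq : ConvexOn ℝ univ fun x : ℝ => Real.cosh x - x ^ 2 / 2 := by
  have h1 : ∀ x : ℝ, HasDerivAt (fun x : ℝ => Real.cosh x - x ^ 2 / 2) (Real.sinh x - x) x := by
    intro x
    have := (Real.hasDerivAt_cosh x).sub ((hasDerivAt_pow 2 x).div_const 2)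
    refine this.congr_deriv ?_
    simp
  have h2 : ∀ x : ℝ, HasDerivAt (fun x : ℝ => Real.sinh x - x) (Real.cosh x - 1) x := fun x =>
    (Real.hasDerivAt_sinh x).sub (hasDerivAt_id x)
  have e1 : deriv (fun x : ℝ => Real.cosh x - x ^ 2 / 2) = fun x => Real.sinh x - x :=
    funext fun x => (h1 x).deriv
  refine convexOn_of_deriv2_nonneg convex_univ
    (continuous_iff_continuousAt.2 fun x => (h1 x).continuousAt).continuousOn
    (fun x _ => (h1 x).differentiableAt.differentiableWithinAt) ?_ fun x _ => ?_
  · rw [e1]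
    exact fun x _ => (h2 x).differentiableAt.differentiableWithinAt
  · rw [Function.iterate_succ_apply, Function.iterate_one, e1, (h2 x).deriv]
    linarith [Real.one_le_cosh x]

theorem cosh_combo_le (a b : ℝ) {s : ℝ} (hs : 0 ≤ s) (hs1 : s ≤ 1) :
    Real.cosh ((1 - s) * a + s * b) + s * (1 - s) / 2 * (a - b) ^ 2
      ≤ (1 - s) * Real.cosh a + s * Real.cosh b := by
  have h := convexOn_cosh_sub_sq.2 (mem_univ a) (mem_univ b) (sub_nonneg.2 hs1) hs (by ring)
  simp only [smul_eq_mul] at h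
  have e : ((1 - s) * a + s * b) ^ 2
      = (1 - s) * a ^ 2 + s * b ^ 2 - s * (1 - s) * (a - b) ^ 2 := by ring
  rw [e] at h
  linarith

theorem one_add_sq_le_cosh (x : ℝ) : 1 + x ^ 2 / 2 ≤ Real.cosh x := by
  -- The midpoint of `x` and `-x` is `0`, where `cosh` equals `1`.
  have h := cosh_combo_le x (-x) (s := 1 / 2) (by norm_num) (by norm_num)
  rw [Real.cosh_neg] at h
  have e : (1 - 1 / 2) * x + 1 / 2 * -x = 0 := by ring
  rw [e, Real.cosh_zero] at h
  linarith

variable {L : ℝ} [Fact (0 < L)]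

/-- The functional `w ↦ ∫ cosh w`. -/
def coshInt (w : L2 L) : ℝ≥0∞ := ∫⁻ x, ENNReal.ofReal (Real.cosh (w x))

theorem aestronglyMeasurable_cosh (w : L2 L) :
    AEStronglyMeasurable (fun x => Real.cosh (w x)) volume :=
  Real.continuous_cosh.comp_aestronglyMeasurable (Lp.aestronglyMeasurable w)

theorem coshInt_ne_top_iff {w : L2 L} :
    coshInt w ≠ ⊤ ↔ Integrable (fun x => Real.cosh (w x)) volume :=
  lintegral_ofReal_ne_top_iff_integrable (aestronglyMeasurable_cosh w)
    (Eventually.of_forall fun _ => (Real.cosh_pos _).le)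

theorem toReal_coshInt (w : L2 L) : (coshInt w).toReal = ∫ x, Real.cosh (w x) :=
  (integral_eq_lintegral_of_nonneg_ae (Eventually.of_forall fun _ => (Real.cosh_pos _).le)
    (aestronglyMeasurable_cosh w)).symm

theorem isLamConvex_coshInt : IsLamConvex (coshInt : L2 L → ℝ≥0∞) 1 := by
  intro u v hu hv s hs hs1
  rw [coshInt_ne_top_iff] at hu hv
  have hpt : ∀ᵐ x ∂(volume : Measure (AddCircle L)),
      Real.cosh (((1 - s) • u + s • v : L2 L) x) + s * (1 - s) / 2 * (u - v : L2 L) x ^ 2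
        ≤ (1 - s) * Real.cosh (u x) + s * Real.cosh (v x) := by
    filter_upwards [Lp.coeFn_add ((1 - s) • u) (s • v), Lp.coeFn_smul (1 - s) u,
      Lp.coeFn_smul s v, Lp.coeFn_sub u v] with x h1 h2 h3 h4
    rw [h1, h4, Pi.add_apply, Pi.sub_apply, h2, h3]
    exact cosh_combo_le _ _ hs hs1
  have hnn : 0 ≤ s * (1 - s) / 2 := by
    have := sub_nonneg.2 hs1
    positivity
  have hR : Integrable (fun x => (1 - s) * Real.cosh (u x) + s * Real.cosh (v x)) volume :=
    (hu.const_mul _).add (hv.const_mul _)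
  have hI : Integrable (fun x => Real.cosh (((1 - s) • u + s • v : L2 L) x)) volume := by
    refine hR.mono' (aestronglyMeasurable_cosh _) ?_
    filter_upwards [hpt] with x hx
    rw [Real.norm_eq_abs, abs_of_pos (Real.cosh_pos _)]
    have := mul_nonneg hnn (sq_nonneg ((u - v : L2 L) x))
    linarith
  refine ⟨coshInt_ne_top_iff.2 hI, ?_⟩
  have hS := (integrable_sq_L2 (u - v)).const_mul (s * (1 - s) / 2)
  have h : ∫ x, (Real.cosh (((1 - s) • u + s • v : L2 L) x)
        + s * (1 - s) / 2 * (u - v : L2 L) x ^ 2)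
      ≤ ∫ x, ((1 - s) * Real.cosh (u x) + s * Real.cosh (v x)) :=
    integral_mono_ae (hI.add hS) hR hpt
  rw [integral_add hI hS, integral_const_mul,
    integral_add (hu.const_mul _) (hv.const_mul _), integral_const_mul, integral_const_mul] at h
  rw [toReal_coshInt, toReal_coshInt, toReal_coshInt, norm_sq_eq_integral]
  linarith

/-- Fatou's lemma along an almost everywhere convergent subsequence. -/
theorem coshInt_le_of_tendsto {w : ℕ → L2 L} {z : L2 L} {c : ℝ≥0∞}
    (hw : Tendsto w atTop (𝓝 z)) (h : ∀ n, coshInt (w n) ≤ c) : coshInt z ≤ c := by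
  obtain ⟨ns, -, hns⟩ := (tendstoInMeasure_of_tendsto_Lp hw).exists_seq_tendsto_ae
  have hm : ∀ n, AEMeasurable (fun x => ENNReal.ofReal (Real.cosh (w (ns n) x))) volume :=
    fun n => (aestronglyMeasurable_cosh _).aemeasurable.ennreal_ofReal
  calc coshInt z = ∫⁻ x, liminf (fun n => ENNReal.ofReal (Real.cosh (w (ns n) x))) atTop := by
        refine lintegral_congr_ae ?_
        filter_upwards [hns] with x hx
        exact (ENNReal.tendsto_ofReal
          ((Real.continuous_cosh.tendsto _).comp hx)).liminf_eq.symm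
    _ ≤ liminf (fun n => coshInt (w (ns n))) atTop := lintegral_liminf_le' hm
    _ ≤ c := liminf_le_of_le (h := fun b hb => by
        obtain ⟨n, hn⟩ := hb.exists
        exact hn.trans (h _))

theorem toReal_coshInt_ge {w : L2 L} (hw : coshInt w ≠ ⊤) :
    L + ‖w‖ ^ 2 / 2 ≤ (coshInt w).toReal := by
  have hL : 0 < L := Fact.out
  rw [toReal_coshInt, norm_sq_eq_integral, ← integral_div]
  have h1 : ∫ x : AddCircle L, (1 : ℝ) = L := by
    simp [Measure.real, AddCircle.measure_univ, ENNReal.toReal_ofReal hL.le]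
  have h2 := (integrable_sq_L2 w).div_const 2
  have h3 : Integrable (fun _ : AddCircle L => (1 : ℝ)) volume := integrable_const 1
  have h4 := integral_add h3 h2
  rw [h1] at h4
  rw [← h4]
  exact integral_mono (h3.add h2) (coshInt_ne_top_iff.1 hw) fun x => one_add_sq_le_cosh _

theorem coshInt_zero : coshInt (0 : L2 L) = ENNReal.ofReal L := by
  have h : coshInt (0 : L2 L) = ∫⁻ _ : AddCircle L, 1 := by
    simp [coshInt]
  rw [h, lintegral_one, AddCircle.measure_univ]

/-! ### The energy -/

theorem IsWeakSecondDeriv.energy_eq {u : H L} {w : L2 L} (h : IsWeakSecondDeriv (u : L2 L) w) :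
    energy u = coshInt w := by
  have hu : MemV u := ⟨w, h⟩
  rw [energy, dif_pos hu, hu.choose_spec.unique h]
  rfl

theorem exists_of_energy_ne_top {u : H L} (h : energy u ≠ ⊤) :
    ∃ w : L2 L, IsWeakSecondDeriv (u : L2 L) w ∧ energy u = coshInt w := by
  by_cases hu : MemV u
  · obtain ⟨w, hw⟩ := hu
    exact ⟨w, hw, hw.energy_eq⟩
  · rw [energy, dif_neg hu] at h
    exact absurd rfl h

theorem isLamConvex_energy : IsLamConvex (energy : H L → ℝ≥0∞) (rate L) := by
  intro u v hu hv s hs hs1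
  obtain ⟨w, hw, ew⟩ := exists_of_energy_ne_top hu
  obtain ⟨z, hz, ez⟩ := exists_of_energy_ne_top hv
  have hc : IsWeakSecondDeriv (((1 - s) • u + s • v : H L) : L2 L) ((1 - s) • w + s • z) :=
    hw.combo hz (1 - s) s
  have hd : IsWeakSecondDeriv ((u - v : H L) : L2 L) (w - z) := hw.sub hz
  rw [hc.energy_eq]
  rw [ew] at hu ⊢
  rw [ez] at hv ⊢
  obtain ⟨h1, h2⟩ := isLamConvex_coshInt w z hu hv s hs hs1
  refine ⟨h1, le_trans ?_ h2⟩
  have h3 := hd.poincare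
  have h4 : 0 ≤ s * (1 - s) := mul_nonneg hs (sub_nonneg.2 hs1)
  have h5 := mul_le_mul_of_nonneg_left h3 h4
  linarith

theorem energy_zero : energy (0 : H L) = ENNReal.ofReal L := by
  have h : IsWeakSecondDeriv ((0 : H L) : L2 L) 0 := isWeakSecondDeriv_zero
  rw [h.energy_eq, coshInt_zero]

theorem energy_zero_ne_top : energy (0 : H L) ≠ ⊤ := by
  rw [energy_zero]
  exact ENNReal.ofReal_ne_top

theorem energy_growth (u : H L) (hu : energy u ≠ ⊤) :
    (energy (0 : H L)).toReal + rate L / 2 * ‖u - 0‖ ^ 2 ≤ (energy u).toReal := by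
  have hL : 0 < L := Fact.out
  obtain ⟨w, hw, ew⟩ := exists_of_energy_ne_top hu
  rw [ew] at hu ⊢
  rw [energy_zero, ENNReal.toReal_ofReal hL.le, sub_zero]
  have h1 := toReal_coshInt_ge hu
  have h2 := hw.poincare
  linarith

/-- Along `x n → u` of bounded energy the second derivatives are bounded but need not converge
strongly. The sets `C n` collect the admissible second derivatives of functions within `1 / (n + 1)`
of `u`; a common element is a second derivative of `u` itself, with `coshInt` at most `c`. -/
theorem lowerSemicontinuous_energy : LowerSemicontinuous (energy : H L → ℝ≥0∞) := by
  rw [lowerSemicontinuous_iff_isClosed_preimage]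
  intro c
  by_cases hc : c = ⊤
  · simp [hc]
  refine IsSeqClosed.isClosed fun x u hx hxu => ?_
  have hε : ∀ n : ℕ, (0 : ℝ) < 1 / (n + 1) := fun n => Nat.one_div_pos_of_nat
  let C : ℕ → Set (L2 L) := fun n => {w | coshInt w ≤ c ∧
    ∃ v : H L, ‖v - u‖ ≤ 1 / ((n : ℝ) + 1) ∧ IsWeakSecondDeriv (v : L2 L) w}
  have hfin : ∀ {w : L2 L}, coshInt w ≤ c → coshInt w ≠ ⊤ := fun h => ne_top_of_le_ne_top hc h
  have hanti : Antitone C := by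
    rintro n m hnm w ⟨hw, v, hv, hvw⟩
    exact ⟨hw, v, hv.trans (Nat.one_div_le_one_div hnm), hvw⟩
  have hcv : ∀ n, Convex ℝ (C n) := by
    rintro n w ⟨hw, v, hv, hvw⟩ w' ⟨hw', v', hv', hvw'⟩ a b ha hb hab
    obtain rfl : a = 1 - b := by linarith
    refine ⟨?_, (1 - b) • v + b • v', ?_, hvw.combo hvw' (1 - b) b⟩
    · obtain ⟨h1, h2⟩ := isLamConvex_coshInt w w' (hfin hw) (hfin hw') b hb (by linarith)
      have h3 := (ENNReal.toReal_le_toReal (hfin hw) hc).2 hw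
      have h4 := (ENNReal.toReal_le_toReal (hfin hw') hc).2 hw'
      rw [← ENNReal.toReal_le_toReal h1 hc]
      have h5 : 0 ≤ 1 / 2 * (b * (1 - b)) * ‖w - w'‖ ^ 2 := by positivity
      have h6 := mul_le_mul_of_nonneg_left h3 ha
      have h7 := mul_le_mul_of_nonneg_left h4 hb
      linarith
    · have h1 : v ∈ Metric.closedBall u (1 / ((n : ℝ) + 1)) := mem_closedBall_iff_norm.2 hv
      have h2 : v' ∈ Metric.closedBall u (1 / ((n : ℝ) + 1)) := mem_closedBall_iff_norm.2 hv'
      exact mem_closedBall_iff_norm.1 (convex_closedBall _ _ h1 h2 ha hb hab)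
  have hcl : ∀ n, IsClosed (C n) := by
    intro n
    refine IsSeqClosed.isClosed fun w z hw hwz => ?_
    choose hw1 v hv hvw using hw
    obtain ⟨y, hy, hyz⟩ := IsWeakSecondDeriv.exists_of_tendsto hvw hwz
    exact ⟨coshInt_le_of_tendsto hwz hw1, y, le_of_tendsto' (hy.sub_const u).norm hv, hyz⟩
  have hne : ∀ n, (C n).Nonempty := by
    intro n
    obtain ⟨k, hk⟩ := ((Metric.tendsto_nhds.1 hxu) _ (hε n)).exists
    have hxk : energy (x k) ≤ c := hx k
    obtain ⟨w, hw, ew⟩ := exists_of_energy_ne_top (ne_top_of_le_ne_top hc hxk)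
    rw [dist_eq_norm] at hk
    exact ⟨w, ew ▸ hxk, x k, hk.le, hw⟩
  have hbd : ∀ w ∈ C 0, ‖w‖ ≤ 1 + 2 * c.toReal := by
    rintro w ⟨hw, -⟩
    have hL : 0 < L := Fact.out
    have h1 := toReal_coshInt_ge (hfin hw)
    have h2 := (ENNReal.toReal_le_toReal (hfin hw) hc).2 hw
    nlinarith [sq_nonneg (‖w‖ - 1)]
  obtain ⟨w, hw⟩ := exists_mem_of_antitone_convex hanti hcv hcl hne hbd
  choose hwc v hv hvw using hw
  obtain ⟨y, hy, hyw⟩ := IsWeakSecondDeriv.exists_of_tendsto hvw tendsto_const_nhds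
  have hvu : Tendsto v atTop (𝓝 u) := by
    rw [tendsto_iff_norm_sub_tendsto_zero]
    exact squeeze_zero (fun _ => norm_nonneg _) hv tendsto_one_div_add_atTop_nhds_zero_nat
  obtain rfl := tendsto_nhds_unique hy hvu
  rw [mem_preimage, mem_Iic, hyw.energy_eq]
  exact hwc 0

/-- Mean-zero functions with an essentially bounded weak second derivative. -/
def boundedSecondDeriv (L : ℝ) [Fact (0 < L)] : Submodule ℝ (H L) where
  carrier := {u | ∃ w : L2 L, IsWeakSecondDeriv (u : L2 L) w ∧ ∃ C : ℝ, ∀ᵐ x, |w x| ≤ C}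
  zero_mem' := by
    exact ⟨0, isWeakSecondDeriv_zero, 0, by simp⟩
  add_mem' := by
    rintro u v ⟨w, hw, C, hC⟩ ⟨z, hz, D, hD⟩
    refine ⟨w + z, ?_, C + D, ?_⟩
    · have := hw.combo hz 1 1
      rw [one_smul, one_smul, one_smul, one_smul] at this
      exact this
    · filter_upwards [hC, hD, Lp.coeFn_add w z] with x h1 h2 h3
      rw [h3, Pi.add_apply]
      exact (abs_add_le _ _).trans (add_le_add h1 h2)
  smul_mem' := by
    rintro a u ⟨w, hw, C, hC⟩
    refine ⟨a • w, ?_, |a| * C, ?_⟩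
    · have := hw.combo isWeakSecondDeriv_zero a 0
      rw [smul_zero, add_zero, add_zero] at this
      exact this
    · filter_upwards [hC, Lp.coeFn_smul a w] with x h1 h2
      rw [h2, Pi.smul_apply, smul_eq_mul, abs_mul]
      gcongr

theorem energy_ne_top_of_mem {u : H L} (hu : u ∈ boundedSecondDeriv L) : energy u ≠ ⊤ := by
  obtain ⟨w, hw, C, hC⟩ := hu
  rw [hw.energy_eq, coshInt_ne_top_iff]
  refine Integrable.of_bound (aestronglyMeasurable_cosh w) (Real.cosh C) ?_
  filter_upwards [hC] with x hx
  rw [Real.norm_eq_abs, abs_of_pos (Real.cosh_pos _), Real.cosh_le_cosh]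
  exact hx.trans (le_abs_self C)

/-- A mode of nonzero frequency is the derivative of another mode, hence has mean zero. -/
theorem integral_ofCont_trig (a : ℂ) {n : ℤ} (hn : n ≠ 0) :
    ∫ x, (ofCont (trig a n) : L2 L) x = 0 := by
  have hf : freq L n ≠ 0 := by
    have hL : 0 < L := Fact.out
    have hn' := norm_freq (L := L) n
    rw [← norm_pos_iff, hn']
    have : 0 < |(n : ℝ)| := abs_pos.2 (Int.cast_ne_zero.2 hn)
    have := Real.pi_pos
    positivity
  have h := (isTest_trig (L := L) (a / freq L n) n).isWeakDeriv.integral_eq_zero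
  rwa [div_mul_cancel₀ a hf] at h

/-- The set is a subspace, so density means trivial orthogonal complement. It contains all
nonconstant trigonometric modes, and a mean-zero function orthogonal to these has no nonzero Fourier
coefficient. -/
theorem dense_boundedSecondDeriv : Dense (boundedSecondDeriv L : Set (H L)) := by
  rw [Submodule.dense_iff_topologicalClosure_eq_top, Submodule.topologicalClosure_eq_top_iff,
    Submodule.eq_bot_iff]
  intro u hu
  rw [Submodule.mem_orthogonal] at hu
  have key : ∀ (a : ℂ) (n : ℤ), n ≠ 0 → (a * fint (u : L2 L) n).re = 0 := by
    intro a n hn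
    rw [← inner_trig]
    let v : H L := ⟨ofCont (trig a n), integral_ofCont_trig a hn⟩
    refine hu v ⟨ofCont (trig (a * freq L n * freq L n) n),
      ⟨_, (isTest_trig a n).isWeakDeriv, (isTest_trig _ n).isWeakDeriv⟩,
      ‖(trig (a * freq L n * freq L n) n : C(AddCircle L, ℝ))‖, ?_⟩
    filter_upwards [coeFn_ofCont (trig (a * freq L n * freq L n) n : C(AddCircle L, ℝ))] with x hx
    rw [hx]
    exact ContinuousMap.norm_coe_le_norm (trig (a * freq L n * freq L n) n : C(AddCircle L, ℝ)) x
  have hz : (u : L2 L) = 0 := by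
    refine eq_zero_of_fint fun n => ?_
    rcases eq_or_ne n 0 with rfl | hn
    · rw [fint_index_zero, integral_H, Complex.ofReal_zero]
    · refine Complex.ext ?_ ?_
      · simpa using key 1 n hn
      · simpa using key Complex.I n hn
  exact Subtype.ext hz

theorem isAdmissible_energy : IsAdmissible (energy : H L → ℝ≥0∞) (rate L) where
  nonneg := rate_pos.le
  convex := isLamConvex_energy
  lsc := lowerSemicontinuous_energy
  dense := dense_boundedSecondDeriv.mono fun _ hu => energy_ne_top_of_mem hu

theorem isMin_energy_iff (u : H L) : (∀ w : H L, energy u ≤ energy w) ↔ u = 0 := by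
  constructor
  · intro h
    have h1 := h 0
    have hu : energy u ≠ ⊤ := ne_top_of_le_ne_top energy_zero_ne_top h1
    have h2 := energy_growth u hu
    have h3 := (ENNReal.toReal_le_toReal hu energy_zero_ne_top).2 h1
    rw [sub_zero] at h2
    have h4 : ‖u‖ ^ 2 ≤ 0 := by
      by_contra hcon
      have := mul_pos (rate_pos (L := L)) (not_le.1 hcon)
      linarith
    have h5 : ‖u‖ = 0 := pow_eq_zero_iff two_ne_zero |>.1 (le_antisymm h4 (sq_nonneg _))
    exact norm_eq_zero.1 h5
  · rintro rfl w
    by_cases hw : energy w = ⊤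
    · rw [hw]; exact le_top
    · rw [← ENNReal.toReal_le_toReal energy_zero_ne_top hw]
      have h2 := energy_growth w hw
      have : 0 ≤ rate L / 2 * ‖w - 0‖ ^ 2 := by
        have := rate_pos (L := L)
        positivity
      linarith

end Energy

end CrystalFlow

end

/-! ### The abstract theory applied to the energy on the circle -/

theorem proposition3p4 (L : ℝ) [Fact (0 < L)] (h₀ : CrystalFlow.H L) :
    -- every backward Euler step is uniquely solvable, so the resolvent is well defined
    (∀ τ : ℝ, 0 < τ → ∀ g : CrystalFlow.H L,
      ∃! v : CrystalFlow.H L, CrystalFlow.IsEulerStep CrystalFlow.energy τ g v) ∧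
    -- `0` is the unique minimizer of the energy
    (∀ u : CrystalFlow.H L, (∀ w : CrystalFlow.H L,
      CrystalFlow.energy u ≤ CrystalFlow.energy w) ↔ u = 0) ∧
    ∃ h : ℝ → CrystalFlow.H L,
      -- convergence to a locally Lipschitz curve, a minimizing movement
      ContinuousOn h (Ici 0) ∧ h 0 = h₀ ∧ LocallyLipschitzOn (Ioi 0) h ∧
      CrystalFlow.IsMinimizingMovement CrystalFlow.energy h₀ h ∧
      (∀ t : ℝ, 0 < t →
        Tendsto (fun n : ℕ => (CrystalFlow.resolvent CrystalFlow.energy (t / n))^[n] h₀)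
          atTop (𝓝 (h t))) ∧
      -- the unique EVI solution
      CrystalFlow.IsEVISolution CrystalFlow.energy (CrystalFlow.rate L) h₀ h ∧
      (∀ g : ℝ → CrystalFlow.H L,
        CrystalFlow.IsEVISolution CrystalFlow.energy (CrystalFlow.rate L) h₀ g →
          EqOn g h (Ici 0)) ∧
      -- regularizing bounds
      (∀ t : ℝ, 0 < t → ∀ v : CrystalFlow.H L, CrystalFlow.energy v ≠ ⊤ →
        CrystalFlow.energy (h t) ≤
          CrystalFlow.energy v + ENNReal.ofReal (1 / (2 * t) * ‖v - h₀‖ ^ 2)) ∧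
      (∀ t : ℝ, 0 < t → ∀ v : CrystalFlow.H L, CrystalFlow.slope CrystalFlow.energy v ≠ ⊤ →
        CrystalFlow.slope CrystalFlow.energy (h t) ^ 2 ≤
          CrystalFlow.slope CrystalFlow.energy v ^ 2 +
            ENNReal.ofReal (1 / t ^ 2 * ‖v - h₀‖ ^ 2)) ∧
      -- exponential decay to the minimizer `0`
      (∀ t₀ t : ℝ, 0 ≤ t₀ → t₀ ≤ t →
        ENNReal.ofReal (CrystalFlow.rate L / 2 * ‖h t - 0‖ ^ 2) ≤
          (CrystalFlow.energy (h t₀) - CrystalFlow.energy (0 : CrystalFlow.H L)) *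
            ENNReal.ofReal (Real.exp (-2 * CrystalFlow.rate L * (t - t₀)))) := by
  have hφ := CrystalFlow.isAdmissible_energy (L := L)
  obtain ⟨h, hh⟩ := hφ.exists_isFlow h₀
  have hE := hh.isEVISolution hφ
  refine ⟨fun τ hτ g => CrystalFlow.existsUnique_isEulerStep hφ.nonneg hφ.convex hφ.lsc hφ.proper
    hτ g, CrystalFlow.isMin_energy_iff, h, hh.continuousOn hφ, hh.zero hφ, hh.locallyLipschitzOn hφ,
    hh.isMinimizingMovement hφ, fun t ht => hh.tendsto_resolvent hφ ht, hE,
    fun g hg => hg.eqOn hφ.proper hE fun a ha => hh.exists_lipschitzOnWith hφ ha,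
    fun t ht v hv => hh.energy_le_add hφ ht hv, fun t ht v hv => hh.slope_sq_le hφ ht hv,
    fun t₀ t ht₀ ht => hh.decay hφ CrystalFlow.energy_zero_ne_top CrystalFlow.energy_growth ht₀ ht⟩
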